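/- Let $r\ge 2$, $p\ge 0$ and $m\ge r+1$ be integers, let $M^r$ be a smooth $r$-dimensional manifold, and let $u:M^r\to\mathbb S^{r+p}\subset\mathbb R^{r+p+1}$ be a smooth immersion into the unit sphere. The cone over $u$ is the map $$f:\mathbb R^+\times\mathbb R^{m-r-1}\times M^r\longrightarrow\mathbb R^{m-r-1}\times\mathbb R^{r+p+1}=\mathbb R^{m+p},\qquad f(t,y,x)=(y,\,t\,u(x)).$$ For an immersed submanifold of dimension $d\ge 2$ in a space form of constant sectional curvature $c$ ($c=0$ for Euclidean space, $c=1$ for the unit sphere) with the induced metric, let $H=\frac1d\sum_j II(e_j,e_j)$ be the mean curvature vector, and $$s=\frac{2}{d(d-1)}\sum_{i<j}\langle R(e_i,e_j)e_j,e_i\rangle,\qquad s^\perp=\frac{2}{d(d-1)}\|R^\perp\|,\qquad \|R^\perp\|^2=\sum_{i<j}\sum_{\alpha<\beta}\langle R^\perp(e_i,e_j)n_\alpha,n_\beta\rangle^2,$$ where $R$ is the Riemann curvature tensor of the induced metric, $R^\perp$ is the curvature tensor of the normal connection, and $(e_i)$, $(n_\alpha)$ are orthonormal bases of the tangent space and of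 the normal space. The submanifold is called Wintgen ideal if $s=c+\|H\|^2-s^\perp$ at every point, and minimal if $H=0$ at every point. Then the cone $f$ is a (smoothly immersed) Wintgen ideal submanifold of $\mathbb R^{m+p}$ if and only if $u$ is a minimal Wintgen ideal submanifold of $\mathbb S^{r+p}$. -/

import Mathlib

open Module Manifold
open scoped ContDiff InnerProductSpace

noncomputable section

namespace WintgenIdeal

/-! ### Riemannian geometry of a metric in local coordinates

`g y` is the metric at the point `y` of an open subset of the coordinate space `V`;
`v w z` are constant (hence commuting) coordinate vector fields. -/

section Metric

variable {V : Type*} [NormedAddCommGroup V] [NormedSpace ℝ V]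

/-- Christoffel symbols of the first kind: the covector
`z ↦ (∂_v g(w, z) + ∂_w g(v, z) - ∂_z g(v, w)) / 2` at `y`. -/
def christoffelLower (g : V → V →L[ℝ] V →L[ℝ] ℝ) (y v w : V) : V →L[ℝ] ℝ :=
  (1 / 2 : ℝ) • (fderiv ℝ g y v w + fderiv ℝ g y w v - ((fderiv ℝ g y).flip v).flip w)

/-- The Levi-Civita covariant derivative `∇_v w` at `y` of the constant field `w`, i.e. the vector
`Γ` with `g(Γ, z) = christoffelLower g y v w z` for all `z` (the index is raised with the inverse
of the metric `g y : V → V*`). -/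
def christoffel (g : V → V →L[ℝ] V →L[ℝ] ℝ) (y v w : V) : V :=
  (g y).inverse (christoffelLower g y v w)

/-- The Riemann curvature tensor `R(v, w) z = ∇_v ∇_w z - ∇_w ∇_v z - ∇_[v, w] z` of the
Levi-Civita connection of `g`, at `y`. -/
def riemannCurvature (g : V → V →L[ℝ] V →L[ℝ] ℝ) (y v w z : V) : V :=
  (fderiv ℝ (fun y' => christoffel g y' w z) y v + christoffel g y v (christoffel g y w z)) -
    (fderiv ℝ (fun y' => christoffel g y' v z) y w + christoffel g y w (christoffel g y v z))

end Metric

/-! ### The ambient space forms -/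

/-- The two standard models of space forms that are needed, both realised inside a Euclidean
vector space `E`: the space `E` itself and the unit sphere of `E`. -/
inductive SpaceForm
  | euclidean
  | unitSphere

/-- The constant sectional curvature of the space form. -/
def SpaceForm.curvature : SpaceForm → ℝ
  | .euclidean => 0
  | .unitSphere => 1

/-- The orthogonal complement in `E` of the tangent space of the space form at its point `a`. -/
def SpaceForm.conormal {E : Type*} [NormedAddCommGroup E] [InnerProductSpace ℝ E] :
    SpaceForm → E → Submodule ℝ E
  | .euclidean, _ => ⊥
  | .unitSphere, a => Submodule.span ℝ {a}

/-! ### Local submanifold geometry of a parametrised submanifold `X : V → E` of a space form -/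

section Local

variable {V : Type*} [NormedAddCommGroup V] [NormedSpace ℝ V]
variable {E : Type*} [NormedAddCommGroup E] [InnerProductSpace ℝ E] [FiniteDimensional ℝ E]

/-- The induced metric (first fundamental form) `g_y(v, w) = ⟪dX_y v, dX_y w⟫`. -/
def inducedMetric (X : V → E) (y : V) : V →L[ℝ] V →L[ℝ] ℝ :=
  (innerSL ℝ (E := E)).bilinearComp (fderiv ℝ X y) (fderiv ℝ X y)

/-- The tangent space of the submanifold at `X y`, as a subspace of `E`. -/
def tangentSpace (X : V → E) (y : V) : Submodule ℝ E :=
  LinearMap.range (fderiv ℝ X y).toLinearMap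

/-- The normal space at `X y` of the submanifold in the space form `Q`: the vectors tangent to
`Q` and orthogonal to the submanifold. -/
def normalSpace (Q : SpaceForm) (X : V → E) (y : V) : Submodule ℝ E :=
  (tangentSpace X y ⊔ Q.conormal (X y))ᗮ

/-- Orthogonal projection of `E` onto the normal space. -/
def normalProj (Q : SpaceForm) (X : V → E) (y : V) : E →L[ℝ] E :=
  (normalSpace Q X y).starProjection

/-- An orthonormal basis `e₁, …, e_m` of the coordinate space `V` for the induced metric at `y`
(no notion below depends on the choice). -/
def tangentFrame (X : V → E) (y : V) (i : Fin (finrank ℝ (tangentSpace X y))) : V :=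
  (LinearMap.mem_range.mp (stdOrthonormalBasis ℝ (tangentSpace X y) i).2).choose

theorem fderiv_tangentFrame (X : V → E) (y : V) (i : Fin (finrank ℝ (tangentSpace X y))) :
    fderiv ℝ X y (tangentFrame X y i) = stdOrthonormalBasis ℝ (tangentSpace X y) i :=
  (LinearMap.mem_range.mp (stdOrthonormalBasis ℝ (tangentSpace X y) i).2).choose_spec

theorem inducedMetric_tangentFrame (X : V → E) (y : V)
    (i j : Fin (finrank ℝ (tangentSpace X y))) :
    inducedMetric X y (tangentFrame X y i) (tangentFrame X y j) = if i = j then 1 else 0 := by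
  change ⟪fderiv ℝ X y (tangentFrame X y i), fderiv ℝ X y (tangentFrame X y j)⟫_ℝ = _
  rw [fderiv_tangentFrame, fderiv_tangentFrame, ← Submodule.coe_inner]
  exact orthonormal_iff_ite.mp (stdOrthonormalBasis ℝ (tangentSpace X y)).orthonormal i j

/-- An orthonormal basis `n₁, …, n_p` of the normal space (no notion below depends on the
choice). -/
def normalFrame (Q : SpaceForm) (X : V → E) (y : V)
    (a : Fin (finrank ℝ (normalSpace Q X y))) : E :=
  stdOrthonormalBasis ℝ (normalSpace Q X y) a

/-- The second fundamental form `II(v, w)` in the space form `Q`: the normal part of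
`∂_v ∂_w X`. -/
def secondFundamentalForm (Q : SpaceForm) (X : V → E) (y v w : V) : E :=
  normalProj Q X y (fderiv ℝ (fun y' => fderiv ℝ X y' w) y v)

/-- The mean curvature vector `H = (1/m) ∑ j, II(e_j, e_j)`. -/
def localMeanCurvature (Q : SpaceForm) (X : V → E) (y : V) : E :=
  (1 / (finrank ℝ V : ℝ)) •
    ∑ j, secondFundamentalForm Q X y (tangentFrame X y j) (tangentFrame X y j)

/-- The normal connection `∇^⊥_v ξ = (∂_v ξ)^⊥`, for a normal vector field `ξ` along `X`. -/
def normalDeriv (Q : SpaceForm) (X : V → E) (ξ : V → E) (v y : V) : E :=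
  normalProj Q X y (fderiv ℝ ξ y v)

/-- The curvature tensor `R^⊥(v, w) ξ = ∇^⊥_v ∇^⊥_w ξ - ∇^⊥_w ∇^⊥_v ξ - ∇^⊥_[v, w] ξ` of the normal
connection at `y`, where the normal vector `ξ` at `y` is extended to the normal vector field
`y' ↦ normalProj Q X y' ξ`. -/
def normalCurvature (Q : SpaceForm) (X : V → E) (y v w : V) (ξ : E) : E :=
  normalDeriv Q X (normalDeriv Q X (fun y' => normalProj Q X y' ξ) w) v y -
    normalDeriv Q X (normalDeriv Q X (fun y' => normalProj Q X y' ξ) v) w y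

/-- The normalised scalar curvature
`s = 2 / (m (m - 1)) * ∑_{i < j} ⟨R(e_i, e_j) e_j, e_i⟩` of the induced metric. -/
def localScalarCurvature (X : V → E) (y : V) : ℝ :=
  2 / ((finrank ℝ V : ℝ) * ((finrank ℝ V : ℝ) - 1)) *
    ∑ i, ∑ j, if i < j then
      inducedMetric X y
        (riemannCurvature (inducedMetric X) y (tangentFrame X y i) (tangentFrame X y j)
          (tangentFrame X y j))
        (tangentFrame X y i)
      else 0

/-- The norm of the normal curvature tensor,
`‖R^⊥‖² = ∑_{i < j} ∑_{a < b} ⟨R^⊥(e_i, e_j) n_a, n_b⟩²`. -/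
def localNormalCurvatureNorm (Q : SpaceForm) (X : V → E) (y : V) : ℝ :=
  √(∑ i, ∑ j, if i < j then
      ∑ a, ∑ b, if a < b then
        ⟪normalCurvature Q X y (tangentFrame X y i) (tangentFrame X y j) (normalFrame Q X y a),
          normalFrame Q X y b⟫_ℝ ^ 2
        else 0
      else 0)

/-- The normalised normal scalar curvature `s^⊥ = 2 / (m (m - 1)) * ‖R^⊥‖`. -/
def localNormalScalarCurvature (Q : SpaceForm) (X : V → E) (y : V) : ℝ :=
  2 / ((finrank ℝ V : ℝ) * ((finrank ℝ V : ℝ) - 1)) * localNormalCurvatureNorm Q X y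

end Local

/-! ### Immersed submanifolds

For a boundaryless manifold `M` modelled on `V` and a map `F : M → E` the local notions are
evaluated at `x` in the preferred chart of `M` at `x`; being tensorial, they do not depend on the
chart. -/

section Manifold

variable {V : Type*} [NormedAddCommGroup V] [NormedSpace ℝ V] {H : Type*} [TopologicalSpace H]
variable (I : ModelWithCorners ℝ V H) {M : Type*} [TopologicalSpace M] [ChartedSpace H M]

/-- A smooth map with injective differential at every point. -/
def IsImmersedSubmanifold {V' : Type*} [NormedAddCommGroup V'] [NormedSpace ℝ V'] {H' : Type*}
    [TopologicalSpace H'] (I' : ModelWithCorners ℝ V' H') {N : Type*} [TopologicalSpace N]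
    [ChartedSpace H' N] (f : M → N) : Prop :=
  ContMDiff I I' ∞ f ∧ ∀ x, Function.Injective (mfderiv I I' f x)

variable {E : Type*} [NormedAddCommGroup E] [InnerProductSpace ℝ E] [FiniteDimensional ℝ E]

/-- The map `F` in the preferred chart at `x`. -/
def inChart (F : M → E) (x : M) : V → E := fun y => F ((extChartAt I x).symm y)

/-- The normalised scalar curvature `s` at `x` of the metric induced by `F`. -/
def scalarCurvature (F : M → E) (x : M) : ℝ :=
  localScalarCurvature (inChart I F x) (extChartAt I x x)

/-- The mean curvature vector `H` at `x` of `F` as a submanifold of the space form `Q`. -/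
def meanCurvature (Q : SpaceForm) (F : M → E) (x : M) : E :=
  localMeanCurvature Q (inChart I F x) (extChartAt I x x)

/-- The normalised normal scalar curvature `s^⊥` at `x` of `F` as a submanifold of the space
form `Q`. -/
def normalScalarCurvature (Q : SpaceForm) (F : M → E) (x : M) : ℝ :=
  localNormalScalarCurvature Q (inChart I F x) (extChartAt I x x)

/-- Equality `s = c + ‖H‖² - s^⊥` in the DDVV inequality at every point. -/
def AttainsDDVV (Q : SpaceForm) (F : M → E) : Prop :=
  ∀ x, scalarCurvature I F x =
    Q.curvature + ‖meanCurvature I Q F x‖ ^ 2 - normalScalarCurvature I Q F x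

/-- `f : M → E` is a Wintgen ideal submanifold of the Euclidean space `E`. -/
def IsWintgenIdealEuclidean (f : M → E) : Prop :=
  IsImmersedSubmanifold I 𝓘(ℝ, E) f ∧ AttainsDDVV I .euclidean f

/-- `u` is a Wintgen ideal submanifold of the unit sphere `S^n` in `ℝ^{n+1}`. -/
def IsWintgenIdealSphere {n : ℕ}
    (u : M → Metric.sphere (0 : EuclideanSpace ℝ (Fin (n + 1))) 1) : Prop :=
  IsImmersedSubmanifold I (𝓡 n) u ∧
    AttainsDDVV I .unitSphere (fun x => (u x : EuclideanSpace ℝ (Fin (n + 1))))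

/-- `u` is a minimal submanifold of the unit sphere `S^n` in `ℝ^{n+1}`. -/
def IsMinimalSphere {n : ℕ}
    (u : M → Metric.sphere (0 : EuclideanSpace ℝ (Fin (n + 1))) 1) : Prop :=
  IsImmersedSubmanifold I (𝓡 n) u ∧
    ∀ x, meanCurvature I .unitSphere (fun x => (u x : EuclideanSpace ℝ (Fin (n + 1)))) x = 0

end Manifold

/-! ### The cone -/

/-- The open half line `ℝ⁺`, as an open submanifold of `ℝ`. -/
def PosReal : TopologicalSpace.Opens ℝ := ⟨Set.Ioi 0, isOpen_Ioi⟩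

/-- The cone `f(t, y, x) = (y, t u(x))` over `u : M → S^n`, with values in the orthogonal direct sum
`ℝ^k × ℝ^{n+1} = ℝ^{k+n+1}`. -/
def cone {M : Type*} {n : ℕ} (k : ℕ)
    (u : M → Metric.sphere (0 : EuclideanSpace ℝ (Fin (n + 1))) 1) :
    PosReal × EuclideanSpace ℝ (Fin k) × M →
      WithLp 2 (EuclideanSpace ℝ (Fin k) × EuclideanSpace ℝ (Fin (n + 1))) :=
  fun z => WithLp.toLp 2 (z.2.1, (z.1 : ℝ) • (u z.2.2 : EuclideanSpace ℝ (Fin (n + 1))))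

end WintgenIdeal

end

/-!
Fix a point of the submanifold and let `A a` be the matrices of its shape operators in orthonormal
tangent and normal frames. By the contracted Gauss equation (`localScalarCurvature_eq`) and the
Ricci equation (`localNormalScalarCurvature_eq`) the curvature `c` of the space form cancels from
`s = c + ‖H‖² - s^⊥`, which becomes (`ddvv_equality_iff`)
`∑ ‖A a‖² - √(∑ ‖[A a, A b]‖²) = (∑ (tr A a)²) / d`, where `d` is the dimension.

The second fundamental form of the cone at distance `t` from the vertex vanishes in the radial and
the Euclidean directions and is that of its link `u` in the others; hence all three sums for
the cone are those of `u`, up to the same power of `t` (`shapeSq_coneMap`, `commSq_coneMap`,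
`traceSq_coneMap`). So the equation for the cone is the one for `u` with `m` instead of `r` in the
denominator. If `u` is minimal, the right-hand sides vanish and the two equations agree.
Conversely, the DDVV inequality for `u` (`traceSq_div_le`) bounds the left-hand side from below by
`(∑ (tr A a)²) / r`, so that equality for the cone and `r < m` force all traces to vanish: `u` is
minimal, and the equations agree again.

The algebraic DDVV inequality `∑ ‖[A a, A b]‖² ≤ (∑ ‖A a‖²)²` for symmetric matrices
(`sum_frob_lie_le_sq`) is proved as follows. Diagonalising the Gram matrix reduces it to
`∑ x k * x l * ‖[B k, B l]‖² ≤ (∑ x k)²` for an orthonormal family `B` and `x ≥ 0`, and writing `x`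
as a nonnegative combination of indicators of nested sets reduces this to
`∑ l ∈ S, ‖[B k, B l]‖² ≤ #S` for `k ∈ S` (`sum_lie_le_card`). If `B k` is diagonal with
eigenvalues `λ i`, Bessel's inequality bounds the excess over `#S - 1` by the sum of the
`(λ i - λ j)² - 1` over the pairs for which this is positive. These pairs form a star because
`∑ λ i ^ 2 = 1`, and then the sum is at most one by Cauchy-Schwarz.
-/

namespace WintgenIdeal

/-! ### The Frobenius inner product -/

/-- The Frobenius inner product of two real square matrices. -/
def frob {n : Type*} [Fintype n] (A B : Matrix n n ℝ) : ℝ := ∑ i, ∑ j, A i j * B i j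

section Frobenius

variable {m n : Type*} [Fintype m] [Fintype n]

theorem frob_comm (A B : Matrix n n ℝ) : frob A B = frob B A := by
  simp only [frob, mul_comm]

theorem frob_self_nonneg (A : Matrix n n ℝ) : 0 ≤ frob A A :=
  Finset.sum_nonneg fun _ _ => Finset.sum_nonneg fun _ _ => mul_self_nonneg _

theorem frob_eq_trace (A B : Matrix n n ℝ) : frob A B = (A.transpose * B).trace := by
  simp only [frob, Matrix.trace, Matrix.diag, Matrix.mul_apply, Matrix.transpose_apply]
  exact Finset.sum_comm

theorem frob_add_right (A B C : Matrix n n ℝ) : frob A (B + C) = frob A B + frob A C := by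
  simp only [frob_eq_trace, Matrix.mul_add, Matrix.trace_add]

theorem frob_smul_right (c : ℝ) (A B : Matrix n n ℝ) : frob A (c • B) = c * frob A B := by
  simp only [frob_eq_trace, Matrix.mul_smul, Matrix.trace_smul, smul_eq_mul]

theorem frob_smul_left (c : ℝ) (A B : Matrix n n ℝ) : frob (c • A) B = c * frob A B := by
  rw [frob_comm, frob_smul_right, frob_comm]

theorem frob_sum_right {κ : Type*} (s : Finset κ) (A : Matrix n n ℝ) (B : κ → Matrix n n ℝ) :
    frob A (∑ k ∈ s, B k) = ∑ k ∈ s, frob A (B k) := by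
  simp only [frob_eq_trace, Matrix.mul_sum, Matrix.trace_sum]

theorem frob_sum_left {κ : Type*} (s : Finset κ) (A : Matrix n n ℝ) (B : κ → Matrix n n ℝ) :
    frob (∑ k ∈ s, B k) A = ∑ k ∈ s, frob (B k) A := by
  simp only [frob_comm _ A, frob_sum_right]

theorem frob_lie_comm (A B : Matrix n n ℝ) : frob ⁅A, B⁆ ⁅A, B⁆ = frob ⁅B, A⁆ ⁅B, A⁆ := by
  rw [Ring.lie_def, Ring.lie_def, ← neg_sub (B * A)]
  simp only [frob, Matrix.neg_apply, neg_mul_neg]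

theorem frob_eq_zero {A : Matrix n n ℝ} (h : frob A A = 0) : A = 0 := by
  ext i j
  have h1 := (Finset.sum_eq_zero_iff_of_nonneg
    (fun i _ => Finset.sum_nonneg fun j _ => mul_self_nonneg (A i j))).1 h i (Finset.mem_univ _)
  have h2 := (Finset.sum_eq_zero_iff_of_nonneg
    (fun j _ => mul_self_nonneg (A i j))).1 h1 j (Finset.mem_univ _)
  simpa using h2

variable [DecidableEq n]

/-- Conjugation by a matrix with orthonormal columns preserves the Frobenius product. -/
theorem frob_conj (O : Matrix m n ℝ) (hO : O.transpose * O = 1) (A B : Matrix n n ℝ) :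
    frob (O * A * O.transpose) (O * B * O.transpose) = frob A B := by
  rw [frob_eq_trace, frob_eq_trace, Matrix.trace_mul_comm]
  have : O * B * O.transpose * (O * A * O.transpose).transpose
      = O * (B * A.transpose * O.transpose) := by
    simp only [Matrix.transpose_mul, Matrix.transpose_transpose, Matrix.mul_assoc]
    rw [← Matrix.mul_assoc O.transpose O, hO, Matrix.one_mul]
  rw [this, Matrix.trace_mul_comm, Matrix.mul_assoc, hO, Matrix.mul_one, Matrix.trace_mul_comm]

theorem lie_conj (O : Matrix m n ℝ) (hO : O.transpose * O = 1) (A B : Matrix n n ℝ) :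
    ⁅O * A * O.transpose, O * B * O.transpose⁆ = O * ⁅A, B⁆ * O.transpose := by
  have h : ∀ A B : Matrix n n ℝ, O * A * O.transpose * (O * B * O.transpose)
      = O * (A * B) * O.transpose := fun A B => by
    simp only [Matrix.mul_assoc]
    rw [← Matrix.mul_assoc O.transpose O, hO, Matrix.one_mul]
  rw [Ring.lie_def, Ring.lie_def, h, h, Matrix.mul_sub, Matrix.sub_mul]

theorem trace_conj (O : Matrix m n ℝ) (hO : O.transpose * O = 1) (A : Matrix n n ℝ) :
    (O * A * O.transpose).trace = A.trace := by
  rw [Matrix.trace_mul_comm, ← Matrix.mul_assoc, hO, Matrix.one_mul]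

end Frobenius

/-! ### Pairs of coordinates of a unit vector that differ by more than one -/

section Star

variable {n : Type*}

/-- The total excess over one of the squared differences along a star with centre `c`. -/
theorem sum_sq_sub_one_star_le (S : Finset n) (x : n → ℝ) (c : ℝ)
    (h : c ^ 2 + ∑ j ∈ S, x j ^ 2 ≤ 1) : ∑ j ∈ S, ((c - x j) ^ 2 - 1) ≤ 1 := by
  have hL := sq_sum_le_card_mul_sum_sq (s := S) (f := x)
  have e : ∑ j ∈ S, ((c - x j) ^ 2 - 1)
      = S.card * (c ^ 2 - 1) - 2 * c * ∑ j ∈ S, x j + ∑ j ∈ S, x j ^ 2 := by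
    rw [Finset.mul_sum, ← nsmul_eq_mul, ← Finset.sum_const, ← Finset.sum_sub_distrib,
      ← Finset.sum_add_distrib]
    exact Finset.sum_congr rfl fun j _ => by ring
  rw [e]
  have hs : (0 : ℝ) ≤ S.card := Nat.cast_nonneg _
  -- `-2 c ∑ x ≤ c² + (∑ x)² ≤ c² + #S ∑ x²`, and then `h` is used `#S + 1` times.
  nlinarith [sq_nonneg (c + ∑ j ∈ S, x j), mul_le_mul_of_nonneg_left h hs]

variable [Fintype n] [DecidableEq n]

/-- For a unit vector `l` the pairs with `1 < l i - l j` form a star, since two disjoint pairs would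
give `∑ l i ^ 2 > 1` and a path of length two would have an end of modulus greater than one. -/
theorem pairs_star (l : n → ℝ) (hl : ∑ i, l i ^ 2 ≤ 1) (P : Finset (n × n))
    (hP : ∀ p ∈ P, 1 < l p.1 - l p.2) (hne : P.Nonempty) :
    (∃ c, ∀ p ∈ P, p.1 = c) ∨ ∃ c, ∀ p ∈ P, p.2 = c := by
  have hone : ∀ i, l i ^ 2 ≤ 1 := fun i =>
    (Finset.single_le_sum (fun i _ => sq_nonneg (l i)) (Finset.mem_univ i)).trans hl
  have hle : ∀ i, l i ≤ 1 := fun i => by nlinarith [hone i]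
  have hge : ∀ i, -1 ≤ l i := fun i => by nlinarith [hone i]
  have hpos : ∀ p ∈ P, 0 < l p.1 ∧ l p.2 < 0 := fun p hp => by
    have := hP p hp
    constructor
    · linarith [hge p.2]
    · linarith [hle p.1]
  have key : ∀ p ∈ P, ∀ q ∈ P, p.1 ≠ q.1 → p.2 = q.2 := by
    intro p hp q hq h1
    by_contra h2
    have d1 : p.1 ≠ p.2 := fun h => by
      have := hpos p hp; rw [h] at this; linarith [this.1, this.2]
    have d2 : p.1 ≠ q.2 := fun h => by
      have a := (hpos p hp).1; have b := (hpos q hq).2; rw [h] at a; linarith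
    have d3 : q.1 ≠ p.2 := fun h => by
      have a := (hpos q hq).1; have b := (hpos p hp).2; rw [h] at a; linarith
    have d4 : q.1 ≠ q.2 := fun h => by
      have := hpos q hq; rw [h] at this; linarith [this.1, this.2]
    have hs : ∑ i ∈ ({p.1, q.1, p.2, q.2} : Finset n), l i ^ 2 ≤ 1 :=
      (Finset.sum_le_sum_of_subset_of_nonneg (Finset.subset_univ _)
        fun i _ _ => sq_nonneg _).trans hl
    rw [Finset.sum_insert (by simp [h1, d1, d2]), Finset.sum_insert (by simp [d3, d4]),
      Finset.sum_insert (by simpa using h2), Finset.sum_singleton] at hs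
    have a := hP p hp
    have b := hP q hq
    -- `(l p.1 - l p.2)² ≤ 2 (l p.1² + l p.2²)`, and the same for `q`.
    nlinarith [sq_nonneg (l p.1 + l p.2), sq_nonneg (l q.1 + l q.2)]
  obtain ⟨p, hp⟩ := hne
  by_cases h : ∀ q ∈ P, q.1 = p.1
  · exact Or.inl ⟨_, h⟩
  · push Not at h
    obtain ⟨q, hq, hqp⟩ := h
    refine Or.inr ⟨p.2, fun s hs => ?_⟩
    by_cases hsp : s.1 = p.1
    · rw [key s hs q hq (by rw [hsp]; exact hqp.symm), key q hq p hp hqp]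
    · exact key s hs p hp hsp

/-- The pairs are oriented, so that each one is counted once. -/
theorem sum_pairs_sub_le_one (l : n → ℝ) (hl : ∑ i, l i ^ 2 ≤ 1) (P : Finset (n × n))
    (hP : ∀ p ∈ P, 1 < l p.1 - l p.2) : ∑ p ∈ P, ((l p.1 - l p.2) ^ 2 - 1) ≤ 1 := by
  rcases P.eq_empty_or_nonempty with rfl | hne
  · simp
  have hcS : ∀ (c : n) (S : Finset n), c ∉ S → l c ^ 2 + ∑ j ∈ S, l j ^ 2 ≤ 1 := by
    intro c S hc
    rw [← Finset.sum_insert (f := fun j => l j ^ 2) hc]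
    exact (Finset.sum_le_sum_of_subset_of_nonneg (Finset.subset_univ _)
      fun i _ _ => sq_nonneg _).trans hl
  rcases pairs_star l hl P hP hne with ⟨c, hc⟩ | ⟨c, hc⟩
  · have hinj : Set.InjOn Prod.snd (P : Set (n × n)) := fun p hp q hq h =>
      Prod.ext ((hc p hp).trans (hc q hq).symm) h
    have := sum_sq_sub_one_star_le (P.image Prod.snd) l (l c) (hcS c _ ?_)
    · rw [Finset.sum_image hinj] at this
      refine le_trans (le_of_eq (Finset.sum_congr rfl fun p hp => ?_)) this
      rw [hc p hp]
    · intro h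
      obtain ⟨p, hp, e⟩ := Finset.mem_image.1 h
      have := hP p hp
      rw [hc p hp, e] at this
      linarith
  · have hinj : Set.InjOn Prod.fst (P : Set (n × n)) := fun p hp q hq h =>
      Prod.ext h ((hc p hp).trans (hc q hq).symm)
    have := sum_sq_sub_one_star_le (P.image Prod.fst) l (l c) (hcS c _ ?_)
    · rw [Finset.sum_image hinj] at this
      refine le_trans (le_of_eq (Finset.sum_congr rfl fun p hp => ?_)) this
      rw [hc p hp]; ring
    · intro h
      obtain ⟨p, hp, e⟩ := Finset.mem_image.1 h
      have := hP p hp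
      rw [hc p hp, e] at this
      linarith

theorem sum_max_sub_le_two (l : n → ℝ) (hl : ∑ i, l i ^ 2 ≤ 1) :
    ∑ i, ∑ j, max ((l i - l j) ^ 2 - 1) 0 ≤ 2 := by
  have hterm : ∀ a b : ℝ, max ((a - b) ^ 2 - 1) 0
      = (if 1 < a - b then (a - b) ^ 2 - 1 else 0) + if 1 < b - a then (b - a) ^ 2 - 1 else 0 := by
    intro a b
    split_ifs with h1 h2 h2
    · linarith
    · rw [max_eq_left (by nlinarith), add_zero]
    · rw [max_eq_left (by nlinarith)]; ring
    · rw [max_eq_right (by nlinarith), add_zero]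
  have h := sum_pairs_sub_le_one l hl
    (Finset.univ.filter fun p : n × n => 1 < l p.1 - l p.2) (by simp)
  rw [Finset.sum_filter, Fintype.sum_prod_type] at h
  simp only [hterm, Finset.sum_add_distrib]
  rw [Finset.sum_comm (f := fun i j => if 1 < l j - l i then (l j - l i) ^ 2 - 1 else 0)]
  simp only at h
  linarith

end Star

/-! ### Commutators in an orthonormal family of symmetric matrices -/

section Commutators

variable {n : Type*} [Fintype n] [DecidableEq n] {κ : Type*} [DecidableEq κ]

/-- Bessel's inequality for the symmetric matrix with entries `1 / 2` at `(i, j)` and `(j, i)`. -/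
theorem sum_sq_entry_le_half (B : κ → Matrix n n ℝ) (hs : ∀ k, (B k).IsSymm)
    (ho : ∀ k l, frob (B k) (B l) = if k = l then 1 else 0) (S : Finset κ) {i j : n} (hij : i ≠ j) :
    ∑ k ∈ S, B k i j ^ 2 ≤ 1 / 2 := by
  set t := ∑ k ∈ S, B k i j ^ 2 with ht
  -- `W` is the projection of that matrix to the span of the family. Its squared norm and its
  -- entries at `(i, j)` and `(j, i)` are all equal to `t`, whence `2 t² ≤ t`.
  set W := ∑ k ∈ S, B k i j • B k with hW
  have hWn : frob W W = t := by
    rw [hW, frob_sum_left]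
    refine Finset.sum_congr rfl fun k hk => ?_
    rw [frob_smul_left, frob_sum_right]
    simp only [frob_smul_right, ho]
    rw [Finset.sum_eq_single_of_mem k hk (fun l _ h => by rw [if_neg h.symm, mul_zero])]
    simp [sq]
  have hWij : W i j = t := by
    simp only [hW, Matrix.sum_apply, Matrix.smul_apply, smul_eq_mul, ht, sq]
  have hWji : W j i = t := by
    simp only [hW, Matrix.sum_apply, Matrix.smul_apply, smul_eq_mul, ht, sq]
    exact Finset.sum_congr rfl fun k _ => by rw [(hs k).apply i j]
  have h2 : W i j * W i j + W j i * W j i ≤ frob W W := by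
    unfold frob
    have h3 : ∀ a b, W a b * W a b ≤ ∑ c, W a c * W a c := fun a b =>
      Finset.single_le_sum (f := fun c => W a c * W a c) (fun c _ => mul_self_nonneg _)
        (Finset.mem_univ b)
    calc _ ≤ ∑ c, W i c * W i c + ∑ c, W j c * W j c := add_le_add (h3 i j) (h3 j i)
      _ = ∑ a ∈ ({i, j} : Finset n), ∑ c, W a c * W a c :=
        (Finset.sum_pair (f := fun a => ∑ c, W a c * W a c) hij).symm
      _ ≤ _ := Finset.sum_le_sum_of_subset_of_nonneg (Finset.subset_univ _) fun a _ _ =>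
        Finset.sum_nonneg fun c _ => mul_self_nonneg _
  rw [hWn, hWij, hWji] at h2
  have : 0 ≤ t := Finset.sum_nonneg fun k _ => sq_nonneg _
  nlinarith

theorem lie_diagonal_apply (l : n → ℝ) (B : Matrix n n ℝ) (i j : n) :
    ⁅Matrix.diagonal l, B⁆ i j = (l i - l j) * B i j := by
  rw [Ring.lie_def, Matrix.sub_apply, Matrix.diagonal_mul, Matrix.mul_diagonal]
  ring

/-- Entrywise, the excess of the squared commutators over the squared norms is weighted by
`(l i - l j) ^ 2 - 1`, and only the pairs where this is positive matter. -/
theorem sum_lie_diagonal_le (l : n → ℝ) (hl : ∑ i, l i ^ 2 ≤ 1) (B : κ → Matrix n n ℝ)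
    (hs : ∀ k, (B k).IsSymm) (ho : ∀ k l, frob (B k) (B l) = if k = l then 1 else 0)
    (S : Finset κ) :
    ∑ k ∈ S, frob ⁅Matrix.diagonal l, B k⁆ ⁅Matrix.diagonal l, B k⁆ ≤ S.card + 1 := by
  have hcard : (S.card : ℝ) = ∑ k ∈ S, frob (B k) (B k) := by simp [ho]
  rw [hcard, ← sub_le_iff_le_add', ← Finset.sum_sub_distrib]
  calc ∑ k ∈ S, (frob ⁅Matrix.diagonal l, B k⁆ ⁅Matrix.diagonal l, B k⁆ - frob (B k) (B k))
      = ∑ k ∈ S, ∑ i, ∑ j, ((l i - l j) ^ 2 - 1) * B k i j ^ 2 := by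
        refine Finset.sum_congr rfl fun k _ => ?_
        simp only [frob, lie_diagonal_apply, ← Finset.sum_sub_distrib]
        exact Finset.sum_congr rfl fun i _ => Finset.sum_congr rfl fun j _ => by ring
    _ = ∑ i, ∑ j, ((l i - l j) ^ 2 - 1) * ∑ k ∈ S, B k i j ^ 2 := by
        rw [Finset.sum_comm]
        refine Finset.sum_congr rfl fun i _ => ?_
        rw [Finset.sum_comm]
        exact Finset.sum_congr rfl fun j _ => by rw [Finset.mul_sum]
    _ ≤ ∑ i, ∑ j, max ((l i - l j) ^ 2 - 1) 0 * (1 / 2) := by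
        refine Finset.sum_le_sum fun i _ => Finset.sum_le_sum fun j _ => ?_
        have h0 : 0 ≤ ∑ k ∈ S, B k i j ^ 2 := Finset.sum_nonneg fun k _ => sq_nonneg _
        refine (mul_le_mul_of_nonneg_right (le_max_left _ 0) h0).trans ?_
        by_cases hij : i = j
        · subst hij; simp
        · exact mul_le_mul_of_nonneg_left (sum_sq_entry_le_half B hs ho S hij) (le_max_right _ _)
    _ ≤ 1 := by
        simp only [← Finset.sum_mul]
        linarith [sum_max_sub_le_two l hl]

/-- The commutators of one member of an orthonormal family of symmetric matrices with the members
of a finite subfamily containing it: the member is diagonalised, and contributes nothing itself. -/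
theorem sum_lie_le_card (B : κ → Matrix n n ℝ) (hs : ∀ k, (B k).IsSymm)
    (ho : ∀ k l, frob (B k) (B l) = if k = l then 1 else 0) (S : Finset κ) {a : κ} (ha : a ∈ S) :
    ∑ k ∈ S, frob ⁅B a, B k⁆ ⁅B a, B k⁆ ≤ S.card := by
  have hH : (B a).IsHermitian := by
    rw [Matrix.IsHermitian, Matrix.conjTranspose_eq_transpose_of_trivial]; exact hs a
  set U : Matrix n n ℝ := (hH.eigenvectorUnitary).1 with hU
  have hUU : U.transpose * U = 1 := by
    have := (Matrix.mem_unitaryGroup_iff').1 hH.eigenvectorUnitary.2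
    rwa [Matrix.star_eq_conjTranspose, Matrix.conjTranspose_eq_transpose_of_trivial] at this
  have hUU' : U * U.transpose = 1 := mul_eq_one_comm.1 hUU
  have hspec : B a = U * Matrix.diagonal hH.eigenvalues * U.transpose := by
    have := hH.spectral_theorem
    rw [Unitary.conjStarAlgAut_apply, Matrix.star_eq_conjTranspose,
      Matrix.conjTranspose_eq_transpose_of_trivial] at this
    exact this
  have hback : ∀ k, B k = U * (U.transpose * B k * U) * U.transpose := fun k => by
    rw [Matrix.mul_assoc U, Matrix.mul_assoc _ U, hUU', Matrix.mul_one, ← Matrix.mul_assoc, hUU',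
      Matrix.one_mul]
  have hUt : U.transpose.transpose * U.transpose = 1 := by rwa [Matrix.transpose_transpose]
  have ho' : ∀ k l, frob (U.transpose * B k * U) (U.transpose * B l * U)
      = if k = l then 1 else 0 := fun k l => by
    have := frob_conj U.transpose hUt (B k) (B l)
    rw [Matrix.transpose_transpose] at this
    rw [this, ho]
  have hs' : ∀ k, (U.transpose * B k * U).IsSymm := fun k => by
    rw [Matrix.IsSymm, Matrix.transpose_mul, Matrix.transpose_mul, Matrix.transpose_transpose,
      (hs k).eq, Matrix.mul_assoc]
  have hl : ∑ i, hH.eigenvalues i ^ 2 ≤ 1 := by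
    have h1 : frob (B a) (B a) = 1 := by simp [ho]
    rw [hspec, frob_conj U hUU] at h1
    simp only [frob, Matrix.diagonal_apply] at h1
    refine le_of_eq (Eq.trans ?_ h1)
    exact Finset.sum_congr rfl fun i _ => by simp [sq]
  have hterm : ∀ k, frob ⁅B a, B k⁆ ⁅B a, B k⁆
      = frob ⁅Matrix.diagonal hH.eigenvalues, U.transpose * B k * U⁆
        ⁅Matrix.diagonal hH.eigenvalues, U.transpose * B k * U⁆ := fun k => by
    conv_lhs => rw [hback k, hspec, lie_conj U hUU, frob_conj U hUU]
  have h := sum_lie_diagonal_le hH.eigenvalues hl _ hs' ho' (S.erase a)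
  rw [← Finset.add_sum_erase S _ ha, Ring.lie_def (B a) (B a), sub_self]
  have hc : ((S.erase a).card : ℝ) + 1 = S.card := by
    exact_mod_cast Finset.card_erase_add_one ha
  rw [hc] at h
  simp only [hterm]
  simpa [frob] using h

/-- A quadratic form is at most the square of the sum of the variables on the nonnegative
orthant as soon as it is so, row by row, at the indicator functions: every nonnegative function is a
nonnegative combination of indicator functions of nested sets. -/
theorem quadratic_le_sq_sum {κ : Type*} (K : κ → κ → ℝ) (hK : ∀ a b, K a b = K b a)
    (h : ∀ S : Finset κ, ∀ a ∈ S, ∑ b ∈ S, K a b ≤ S.card) (S : Finset κ) :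
    ∀ x : κ → ℝ, (∀ a ∈ S, 0 ≤ x a) →
      ∑ a ∈ S, ∑ b ∈ S, x a * x b * K a b ≤ (∑ a ∈ S, x a) ^ 2 := by
  classical
  induction S using Finset.strongInduction with
  | H S ih =>
    intro x hx
    rcases S.eq_empty_or_nonempty with rfl | hne
    · simp
    obtain ⟨c, hc, hmin⟩ := S.exists_min_image x hne
    set t := x c with ht
    have ht0 : 0 ≤ t := hx c hc
    -- Peel off `t` times the indicator of `S`; the remainder `y` vanishes at `c`.
    set y : κ → ℝ := fun a => x a - t with hy
    have hyc : y c = 0 := by simp [hy, ht]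
    have hy0 : ∀ a ∈ S, 0 ≤ y a := fun a ha => sub_nonneg.2 (hmin a ha)
    have ih' := ih (S.erase c) (Finset.erase_ssubset hc) y
      (fun a ha => hy0 a (Finset.mem_of_mem_erase ha))
    have e1 : ∑ a ∈ S.erase c, y a = ∑ a ∈ S, y a := Finset.sum_erase _ hyc
    have e2 : ∑ a ∈ S.erase c, ∑ b ∈ S.erase c, y a * y b * K a b
        = ∑ a ∈ S, ∑ b ∈ S, y a * y b * K a b := by
      rw [Finset.sum_erase _ (by simp [hyc])]
      exact Finset.sum_congr rfl fun a _ => Finset.sum_erase _ (by simp [hyc])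
    rw [e1, e2] at ih'
    have hcross : ∑ a ∈ S, y a * ∑ b ∈ S, K a b ≤ S.card * ∑ a ∈ S, y a := by
      rw [Finset.mul_sum]
      refine Finset.sum_le_sum fun a ha => ?_
      rw [mul_comm]
      exact mul_le_mul_of_nonneg_right (h S a ha) (hy0 a ha)
    have hconst : ∑ a ∈ S, ∑ b ∈ S, K a b ≤ S.card * S.card := by
      refine (Finset.sum_le_sum fun a ha => h S a ha).trans (le_of_eq ?_)
      rw [Finset.sum_const, nsmul_eq_mul]
    have hsum : ∑ a ∈ S, x a = ∑ a ∈ S, y a + S.card * t := by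
      simp only [hy, Finset.sum_sub_distrib, Finset.sum_const, nsmul_eq_mul]; ring
    have hsym : ∑ a ∈ S, ∑ b ∈ S, y b * K a b = ∑ a ∈ S, y a * ∑ b ∈ S, K a b := by
      rw [Finset.sum_comm]
      refine Finset.sum_congr rfl fun a _ => ?_
      rw [Finset.mul_sum]
      exact Finset.sum_congr rfl fun b _ => by rw [hK]
    have hquad : ∑ a ∈ S, ∑ b ∈ S, x a * x b * K a b
        = ∑ a ∈ S, ∑ b ∈ S, y a * y b * K a b + 2 * t * (∑ a ∈ S, y a * ∑ b ∈ S, K a b)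
          + t ^ 2 * ∑ a ∈ S, ∑ b ∈ S, K a b := by
      have : ∀ a b, x a * x b * K a b
          = y a * y b * K a b + t * (y a * K a b) + t * (y b * K a b) + t ^ 2 * K a b := by
        intro a b; simp only [hy]; ring
      simp only [this, Finset.sum_add_distrib, ← Finset.mul_sum, hsym]
      ring
    rw [hquad, hsum]
    have := mul_le_mul_of_nonneg_left hcross ht0
    have := mul_le_mul_of_nonneg_left hconst (sq_nonneg t)
    nlinarith

end Commutators

/-! ### The algebraic DDVV inequality -/

section DDVV

variable {n : Type*} [Fintype n] {κ κ' : Type*} [Fintype κ] [Fintype κ'] [DecidableEq κ']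

/-- If the coefficient vectors of `A` with respect to `B` are orthogonal with squared norms `x`,
the family `A` has the same covariance operator as the family `√x • B`. -/
theorem sum_frob_map (A : κ → Matrix n n ℝ) (B : κ' → Matrix n n ℝ) (a : κ → κ' → ℝ)
    (x : κ' → ℝ) (hA : ∀ k, A k = ∑ l, a k l • B l)
    (ha : ∀ l l', ∑ k, a k l * a k l' = if l = l' then x l else 0)
    (L : Matrix n n ℝ →ₗ[ℝ] Matrix n n ℝ) :
    ∑ k, frob (L (A k)) (L (A k)) = ∑ l, x l * frob (L (B l)) (L (B l)) := by
  have h1 : ∀ k, frob (L (A k)) (L (A k))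
      = ∑ l, ∑ l', a k l * a k l' * frob (L (B l)) (L (B l')) := fun k => by
    rw [hA k, map_sum, frob_sum_left]
    refine Finset.sum_congr rfl fun l _ => ?_
    rw [frob_sum_right]
    refine Finset.sum_congr rfl fun l' _ => ?_
    rw [map_smul, map_smul, frob_smul_left, frob_smul_right]; ring
  simp only [h1]
  rw [Finset.sum_comm]
  refine Finset.sum_congr rfl fun l _ => ?_
  rw [Finset.sum_comm]
  simp only [← Finset.sum_mul, ha]
  simp

/-- `sum_frob_map` applied to both arguments of the commutator. -/
theorem sum_frob_lie_comb [DecidableEq n] (A : κ → Matrix n n ℝ) (B : κ' → Matrix n n ℝ)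
    (a : κ → κ' → ℝ) (x : κ' → ℝ) (hA : ∀ k, A k = ∑ l, a k l • B l)
    (ha : ∀ l l', ∑ k, a k l * a k l' = if l = l' then x l else 0) :
    ∑ k, ∑ k', frob ⁅A k, A k'⁆ ⁅A k, A k'⁆
      = ∑ l, ∑ l', x l * x l' * frob ⁅B l, B l'⁆ ⁅B l, B l'⁆ := by
  have hM : ∀ Y, ∑ k, frob ⁅Y, A k⁆ ⁅Y, A k⁆ = ∑ l, x l * frob ⁅Y, B l⁆ ⁅Y, B l⁆ := fun Y => by
    have h := sum_frob_map A B a x hA ha (LinearMap.mulLeft ℝ Y - LinearMap.mulRight ℝ Y)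
    simpa only [LinearMap.sub_apply, LinearMap.mulLeft_apply, LinearMap.mulRight_apply,
      ← Ring.lie_def] using h
  have hneg : ∀ X Y : Matrix n n ℝ, frob ⁅X, Y⁆ ⁅X, Y⁆ = frob ⁅Y, X⁆ ⁅Y, X⁆ := frob_lie_comm
  simp only [hM]
  rw [Finset.sum_comm]
  simp only [← Finset.mul_sum]
  refine Finset.sum_congr rfl fun l _ => ?_
  simp only [hneg _ (B l), hM, Finset.mul_sum, mul_assoc]

/-- Diagonalisation of the Gram matrix of a finite family of symmetric matrices. -/
theorem exists_orthonormal_comb [DecidableEq κ] (A : κ → Matrix n n ℝ) (hA : ∀ k, (A k).IsSymm) :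
    ∃ (s : Finset κ) (B : s → Matrix n n ℝ) (a : κ → s → ℝ) (x : s → ℝ), (∀ l, (B l).IsSymm) ∧
      (∀ l l', frob (B l) (B l') = if l = l' then 1 else 0) ∧ (∀ l, 0 ≤ x l) ∧
      (∀ k, A k = ∑ l, a k l • B l) ∧
      ∀ l l', ∑ k, a k l * a k l' = if l = l' then x l else 0 := by
  classical
  set G : Matrix κ κ ℝ := Matrix.of fun k l => frob (A k) (A l) with hG
  have hH : G.IsHermitian := by
    rw [Matrix.IsHermitian, Matrix.conjTranspose_eq_transpose_of_trivial]
    ext i j; exact frob_comm _ _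
  set U : Matrix κ κ ℝ := (hH.eigenvectorUnitary).1 with hU
  set x := hH.eigenvalues with hx
  have hUU : U.transpose * U = 1 := by
    have := (Matrix.mem_unitaryGroup_iff').1 hH.eigenvectorUnitary.2
    rwa [Matrix.star_eq_conjTranspose, Matrix.conjTranspose_eq_transpose_of_trivial] at this
  have hUU' : U * U.transpose = 1 := mul_eq_one_comm.1 hUU
  have hspec : G = U * Matrix.diagonal x * U.transpose := by
    have := hH.spectral_theorem
    rw [Unitary.conjStarAlgAut_apply, Matrix.star_eq_conjTranspose,
      Matrix.conjTranspose_eq_transpose_of_trivial] at this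
    exact this
  have hdiag : U.transpose * G * U = Matrix.diagonal x := by
    rw [hspec, Matrix.mul_assoc, Matrix.mul_assoc, hUU, Matrix.mul_one, ← Matrix.mul_assoc, hUU,
      Matrix.one_mul]
  have hUcol : ∀ l l', ∑ k, U k l * U k l' = if l = l' then 1 else 0 := fun l l' => by
    have := congrFun (congrFun hUU l) l'
    simpa [Matrix.mul_apply, Matrix.one_apply] using this
  have hUrow : ∀ k k', ∑ l, U k l * U k' l = if k = k' then 1 else 0 := fun l l' => by
    have := congrFun (congrFun hUU' l) l'
    simpa [Matrix.mul_apply, Matrix.one_apply] using this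
  -- The rotated family `C` is orthogonal; its nonzero members, normalised, are the family wanted.
  set C : κ → Matrix n n ℝ := fun l => ∑ k, U k l • A k with hC
  have hCC : ∀ l l', frob (C l) (C l') = if l = l' then x l else 0 := fun l l' => by
    have := congrFun (congrFun hdiag l) l'
    rw [Matrix.diagonal_apply] at this
    rw [← this, hC, frob_sum_left, Matrix.mul_assoc]
    rw [Matrix.mul_apply]
    refine Finset.sum_congr rfl fun k _ => ?_
    rw [frob_smul_left, frob_sum_right, Matrix.mul_apply, Matrix.transpose_apply]
    congr 1
    refine Finset.sum_congr rfl fun k' _ => ?_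
    rw [frob_smul_right, mul_comm]; rfl
  have hAC : ∀ k, A k = ∑ l, U k l • C l := fun k => by
    simp only [hC, Finset.smul_sum, smul_smul]
    rw [Finset.sum_comm]
    simp only [← Finset.sum_smul, hUrow]
    simp
  have hCs : ∀ l, (C l).IsSymm := fun l => by
    rw [Matrix.IsSymm, hC, Matrix.transpose_sum]
    exact Finset.sum_congr rfl fun k _ => by rw [Matrix.transpose_smul, (hA k).eq]
  have hx0 : ∀ l, 0 ≤ x l := fun l => by
    have := hCC l l
    rw [if_pos rfl] at this
    exact this ▸ frob_self_nonneg _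
  set s := Finset.univ.filter fun l => x l ≠ 0 with hs
  have hpos : ∀ l : s, 0 < x l := fun l =>
    lt_of_le_of_ne (hx0 l) (Ne.symm (Finset.mem_filter.1 l.2).2)
  refine ⟨s, fun l => (√(x l))⁻¹ • C l, fun k l => √(x l) * U k l, fun l => x l, ?_, ?_, ?_, ?_, ?_⟩
  · intro l
    exact (hCs l).smul _
  · intro l l'
    rw [frob_smul_left, frob_smul_right, hCC]
    by_cases h : l = l'
    · subst h
      rw [if_pos rfl, if_pos rfl]
      have h1 := Real.mul_self_sqrt (hpos l).le
      have h2 := (Real.sqrt_pos.2 (hpos l)).ne'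
      field_simp
      linarith
    · rw [if_neg (fun e => h (Subtype.ext e)), if_neg h]; simp
  · exact fun l => hx0 l
  · intro k
    have h1 : ∀ l : s, (√(x l) * U k l) • (√(x l))⁻¹ • C l = U k l • C l := fun l => by
      rw [smul_smul]
      congr 1
      have h2 := (Real.sqrt_pos.2 (hpos l)).ne'
      field_simp
    simp only [h1]
    rw [Finset.sum_coe_sort s (fun l => U k l • C l), hAC k]
    symm
    refine Finset.sum_subset (Finset.subset_univ _) fun l _ hl => ?_
    have hxl : x l = 0 := by simpa [hs] using hl
    have : C l = 0 := frob_eq_zero (by rw [hCC, if_pos rfl, hxl])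
    rw [this, smul_zero]
  · intro l l'
    have h1 : ∀ k, √(x l) * U k l * (√(x l') * U k l') = √(x l) * √(x l') * (U k l * U k l') :=
      fun k => by ring
    simp only [h1, ← Finset.mul_sum, hUcol]
    by_cases h : l = l'
    · subst h; simp [Real.mul_self_sqrt (hpos l).le]
    · rw [if_neg (fun e => h (Subtype.ext e)), if_neg h, mul_zero]

/-- The algebraic DDVV inequality. -/
theorem sum_frob_lie_le_sq [DecidableEq n] (A : κ → Matrix n n ℝ) (hA : ∀ k, (A k).IsSymm) :
    ∑ k, ∑ k', frob ⁅A k, A k'⁆ ⁅A k, A k'⁆ ≤ (∑ k, frob (A k) (A k)) ^ 2 := by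
  classical
  obtain ⟨s, B, a, x, hBs, hBo, hx, hAB, ha⟩ := exists_orthonormal_comb A hA
  have hn := sum_frob_map A B a x hAB ha LinearMap.id
  simp only [LinearMap.id_coe, id_eq, hBo, if_true, mul_one] at hn
  rw [sum_frob_lie_comb A B a x hAB ha, hn]
  refine quadratic_le_sq_sum (fun l l' => frob ⁅B l, B l'⁆ ⁅B l, B l'⁆) (fun l l' => ?_)
    (fun S l hl => sum_lie_le_card B hBs hBo S hl) Finset.univ x (fun l _ => hx l)
  exact frob_lie_comm _ _

/-- The DDVV inequality for the trace-free parts: subtracting multiples of the identity does not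
change the commutators. -/
theorem sum_trace_sq_div_le [DecidableEq n] [Nonempty n] (A : κ → Matrix n n ℝ)
    (hA : ∀ k, (A k).IsSymm) :
    (∑ k, (A k).trace ^ 2) / Fintype.card n ≤ ∑ k, frob (A k) (A k)
      - √(∑ k, ∑ k', frob ⁅A k, A k'⁆ ⁅A k, A k'⁆) := by
  set d : ℝ := (Fintype.card n : ℝ) with hd
  have hd0 : d ≠ 0 := by simp [hd, Fintype.card_ne_zero]
  set B : κ → Matrix n n ℝ := fun k => A k - ((A k).trace / d) • (1 : Matrix n n ℝ) with hB
  have hBs : ∀ k, (B k).IsSymm := fun k =>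
    (hA k).sub ((Matrix.isSymm_one).smul _)
  have hlie : ∀ k k', ⁅B k, B k'⁆ = ⁅A k, A k'⁆ := fun k k' => by
    simp only [hB, Ring.lie_def, Matrix.sub_mul, Matrix.mul_sub, Matrix.smul_mul, Matrix.mul_smul,
      Matrix.one_mul, Matrix.mul_one]
    module
  have hfr : ∀ k, frob (B k) (B k) = frob (A k) (A k) - (A k).trace ^ 2 / d := fun k => by
    have h1 : ∀ M : Matrix n n ℝ, frob M 1 = M.trace := fun M => by
      rw [frob_eq_trace, Matrix.mul_one, Matrix.trace_transpose]
    have h2 : frob (B k) (B k)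
        = frob (B k) (A k) + frob (B k) ((-((A k).trace / d)) • (1 : Matrix n n ℝ)) := by
      rw [← frob_add_right]; congr 1; simp only [hB, neg_smul, sub_eq_add_neg]
    have h3 : frob (A k) (B k)
        = frob (A k) (A k) + frob (A k) ((-((A k).trace / d)) • (1 : Matrix n n ℝ)) := by
      rw [← frob_add_right]; congr 1; simp only [hB, neg_smul, sub_eq_add_neg]
    have h4 : (B k).trace = 0 := by
      simp only [hB, Matrix.trace_sub, Matrix.trace_smul, Matrix.trace_one, smul_eq_mul, ← hd]
      field_simp; ring
    rw [h2, frob_smul_right, h1, h4, frob_comm, h3, frob_smul_right, h1]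
    ring
  have h := sum_frob_lie_le_sq B hBs
  simp only [hlie, hfr, Finset.sum_sub_distrib, ← Finset.sum_div] at h
  have h0 : 0 ≤ ∑ k, frob (A k) (A k) - (∑ k, (A k).trace ^ 2) / d := by
    have : 0 ≤ ∑ k, frob (B k) (B k) := Finset.sum_nonneg fun k _ => frob_self_nonneg _
    simpa only [hfr, Finset.sum_sub_distrib, ← Finset.sum_div] using this
  have := Real.sqrt_le_sqrt h
  rw [Real.sqrt_sq h0] at this
  linarith

end DDVV

/-! ### Differentiability of the tangential and normal projections -/

section Local

open Filter Topology

variable {V : Type*} [NormedAddCommGroup V] [NormedSpace ℝ V]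
variable {E : Type*} [NormedAddCommGroup E] [InnerProductSpace ℝ E]

/-- The points of the Euclidean space `E` that lie on the standard model of the space form. -/
noncomputable def SpaceForm.Mem : SpaceForm → E → Prop
  | .euclidean, _ => True
  | .unitSphere, a => ‖a‖ = 1

/-- `X` is a `C³` immersion into the space form `Q` near `y`. Three derivatives suffice for the
curvature tensors, and unlike `C^∞` regularity at a point, `C³` regularity is an open condition. -/
structure IsRegularAt (Q : SpaceForm) (X : V → E) (y : V) : Prop where
  contDiffAt : ContDiffAt ℝ 3 X y
  injective : Function.Injective (fderiv ℝ X y)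
  mem : ∀ᶠ y' in 𝓝 y, Q.Mem (X y')

namespace IsRegularAt

variable {Q : SpaceForm} {X : V → E} {y : V}

theorem contDiffAt_fderiv (h : IsRegularAt Q X y) : ContDiffAt ℝ 2 (fderiv ℝ X) y :=
  h.contDiffAt.fderiv_right (by norm_num)

theorem differentiableAt (h : IsRegularAt Q X y) : DifferentiableAt ℝ X y :=
  h.contDiffAt.differentiableAt (by norm_num)

theorem differentiableAt_fderiv (h : IsRegularAt Q X y) : DifferentiableAt ℝ (fderiv ℝ X) y :=
  h.contDiffAt_fderiv.differentiableAt (by norm_num)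

theorem differentiableAt_fderiv_fderiv (h : IsRegularAt Q X y) :
    DifferentiableAt ℝ (fderiv ℝ (fderiv ℝ X)) y :=
  (h.contDiffAt_fderiv.fderiv_right (m := 1) (by norm_num)).differentiableAt (by norm_num)

theorem eventually [FiniteDimensional ℝ V] (h : IsRegularAt Q X y) :
    ∀ᶠ y' in 𝓝 y, IsRegularAt Q X y' := by
  have h2 : ∀ᶠ y' in 𝓝 y, Function.Injective (fderiv ℝ X y') :=
    h.contDiffAt_fderiv.continuousAt.eventually_mem
      (ContinuousLinearMap.isOpen_injective.mem_nhds h.injective)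
  filter_upwards [h.contDiffAt.eventually (by decide), h2, h.mem.eventually_nhds] with z a b c
  exact ⟨a, b, c⟩

theorem mem_self (h : IsRegularAt Q X y) : Q.Mem (X y) := h.mem.self_of_nhds

theorem euclidean (h : IsRegularAt Q X y) : IsRegularAt .euclidean X y :=
  ⟨h.contDiffAt, h.injective, Eventually.of_forall fun _ => trivial⟩

theorem snd_symm (h : IsRegularAt Q X y) (v w : V) :
    fderiv ℝ (fderiv ℝ X) y v w = fderiv ℝ (fderiv ℝ X) y w v :=
  h.contDiffAt.isSymmSndFDerivAt (by simp; norm_num) v w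

theorem fderiv_apply_const (h : IsRegularAt Q X y) (v w : V) :
    fderiv ℝ (fun y' => fderiv ℝ X y' w) y v = fderiv ℝ (fderiv ℝ X) y v w := by
  rw [fderiv_clm_apply h.differentiableAt_fderiv (differentiableAt_const _)]
  simp

theorem inner_self_fderiv (h : IsRegularAt .unitSphere X y) (v : V) :
    ⟪X y, fderiv ℝ X y v⟫_ℝ = 0 := by
  have h1 : (fun y' => ⟪X y', X y'⟫_ℝ) =ᶠ[𝓝 y] fun _ => 1 := by
    filter_upwards [h.mem] with z hz
    rw [real_inner_self_eq_norm_sq, show ‖X z‖ = 1 from hz, one_pow]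
  have h2 := fderiv_inner_apply ℝ h.differentiableAt h.differentiableAt v
  rw [h1.fderiv_eq, fderiv_fun_const, real_inner_comm (X y)] at h2
  simp only [Pi.zero_apply, zero_apply] at h2
  linarith

/-- Differentiating `⟪X, ∂_w X⟫ = 0`. -/
theorem inner_self_snd (h : IsRegularAt .unitSphere X y) [FiniteDimensional ℝ V] (v w : V) :
    ⟪X y, fderiv ℝ (fderiv ℝ X) y v w⟫_ℝ = - ⟪fderiv ℝ X y v, fderiv ℝ X y w⟫_ℝ := by
  have h1 : (fun y' => ⟪X y', fderiv ℝ X y' w⟫_ℝ) =ᶠ[𝓝 y] fun _ => 0 := by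
    filter_upwards [h.eventually] with z hz using hz.inner_self_fderiv w
  have h2 := fderiv_inner_apply ℝ h.differentiableAt
    (h.differentiableAt_fderiv.clm_apply (differentiableAt_const w)) v
  rw [h1.fderiv_eq, fderiv_fun_const, h.fderiv_apply_const] at h2
  simp only [Pi.zero_apply, zero_apply] at h2
  linarith

end IsRegularAt

variable [FiniteDimensional ℝ V] {Q : SpaceForm} {X : V → E} {y : V}

omit [FiniteDimensional ℝ V] in
theorem inducedMetric_apply (X : V → E) (y v w : V) :
    inducedMetric X y v w = ⟪fderiv ℝ X y v, fderiv ℝ X y w⟫_ℝ := rfl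

/-- The transpose of the differential of `X` at `y`, with values in the dual of `V`. -/
noncomputable def tangentCoord (X : V → E) (y : V) : E →L[ℝ] V →L[ℝ] ℝ :=
  ((ContinuousLinearMap.compL ℝ V E ℝ).flip (fderiv ℝ X y)).comp (innerSL ℝ)

omit [FiniteDimensional ℝ V] in
theorem tangentCoord_apply (X : V → E) (y : V) (e : E) (v : V) :
    tangentCoord X y e v = ⟪e, fderiv ℝ X y v⟫_ℝ := rfl

omit [FiniteDimensional ℝ V] in
theorem contDiffAt_tangentCoord (h : IsRegularAt Q X y) : ContDiffAt ℝ 2 (tangentCoord X) y :=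
  ((ContinuousLinearMap.contDiff _).contDiffAt.comp y h.contDiffAt_fderiv).clm_comp
    contDiffAt_const

theorem isInvertible_inducedMetric (h : Function.Injective (fderiv ℝ X y)) :
    (inducedMetric X y).IsInvertible := by
  have hinj : Function.Injective (inducedMetric X y) := by
    rw [injective_iff_map_eq_zero]
    intro v hv
    have : inducedMetric X y v v = 0 := by rw [hv]; rfl
    rw [inducedMetric_apply, inner_self_eq_zero] at this
    exact (injective_iff_map_eq_zero (fderiv ℝ X y)).1 h v this
  have hfin : finrank ℝ V = finrank ℝ (V →L[ℝ] ℝ) := by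
    rw [← (LinearMap.toContinuousLinearMap (𝕜 := ℝ) (E := V) (F' := ℝ)).finrank_eq]
    exact Subspace.dual_finrank_eq.symm
  let e := LinearEquiv.ofInjectiveOfFinrankEq (inducedMetric X y).toLinearMap hinj hfin
  exact ⟨e.toContinuousLinearEquiv, by ext; rfl⟩

omit [FiniteDimensional ℝ V] in
theorem contDiffAt_inducedMetric (h : IsRegularAt Q X y) : ContDiffAt ℝ 2 (inducedMetric X) y :=
  (contDiffAt_tangentCoord h).clm_comp h.contDiffAt_fderiv

theorem contDiffAt_inverse_inducedMetric (h : IsRegularAt Q X y) :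
    ContDiffAt ℝ 2 (fun y' => (inducedMetric X y').inverse) y := by
  have := FiniteDimensional.complete ℝ V
  exact ((isInvertible_inducedMetric h.injective).contDiffAt_map_inverse).comp y
    (contDiffAt_inducedMetric h)

/-- The orthogonal projection onto the tangent space, by the formula `D g⁻¹ Dᵀ` that makes its
smooth dependence on the point visible. -/
noncomputable def tangentProj (X : V → E) (y : V) : E →L[ℝ] E :=
  (fderiv ℝ X y).comp ((inducedMetric X y).inverse.comp (tangentCoord X y))

/-- Defining property of the tangential projection; it needs the metric to be invertible, as
`ContinuousLinearMap.inverse` is zero otherwise. -/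
theorem inner_tangentProj (h : Function.Injective (fderiv ℝ X y)) (e : E) (v : V) :
    ⟪tangentProj X y e, fderiv ℝ X y v⟫_ℝ = ⟪e, fderiv ℝ X y v⟫_ℝ := by
  change inducedMetric X y ((inducedMetric X y).inverse (tangentCoord X y e)) v = _
  rw [(isInvertible_inducedMetric h).self_apply_inverse]
  rfl

omit [FiniteDimensional ℝ V] in
theorem tangentProj_mem (X : V → E) (y : V) (e : E) : tangentProj X y e ∈ tangentSpace X y :=
  LinearMap.mem_range_self _ _

theorem contDiffAt_tangentProj (h : IsRegularAt Q X y) : ContDiffAt ℝ 2 (tangentProj X) y := by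
  exact h.contDiffAt_fderiv.clm_comp
    ((contDiffAt_inverse_inducedMetric h).clm_comp (contDiffAt_tangentCoord h))

variable [FiniteDimensional ℝ E]

/-- The orthogonal projection onto the conormal space at a point of the space form. -/
noncomputable def SpaceForm.conormalProj : SpaceForm → E → E →L[ℝ] E
  | .euclidean, _ => 0
  | .unitSphere, a => (innerSL ℝ a).smulRight a

/-- This formula shows that the normal projection depends smoothly on the point. -/
theorem normalProj_eq (h : IsRegularAt Q X y) :
    normalProj Q X y = ContinuousLinearMap.id ℝ E - tangentProj X y - Q.conormalProj (X y) := by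
  ext e
  refine Submodule.eq_starProjection_of_mem_orthogonal ?_ ?_
  · rw [normalSpace, ← Submodule.inf_orthogonal, Submodule.mem_inf]
    constructor
    · rw [Submodule.mem_orthogonal']
      rintro _ ⟨v, rfl⟩
      simp only [sub_apply, ContinuousLinearMap.id_apply, inner_sub_left,
        ContinuousLinearMap.coe_coe, inner_tangentProj h.injective, sub_self, zero_sub,
        neg_eq_zero]
      cases Q with
      | euclidean => simp [SpaceForm.conormalProj]
      | unitSphere =>
        simp [SpaceForm.conormalProj, inner_smul_left, h.inner_self_fderiv]
    · cases Q with
      | euclidean => simp [SpaceForm.conormal]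
      | unitSphere =>
        have hX : ‖X y‖ = 1 := h.mem_self
        rw [SpaceForm.conormal, Submodule.mem_orthogonal_singleton_iff_inner_right]
        have : ⟪X y, tangentProj X y e⟫_ℝ = 0 := h.inner_self_fderiv _
        simp [SpaceForm.conormalProj, inner_sub_right, inner_smul_right, hX, this]
  · have : e - (ContinuousLinearMap.id ℝ E - tangentProj X y - Q.conormalProj (X y)) e
        = tangentProj X y e + Q.conormalProj (X y) e := by
      simp only [sub_apply, ContinuousLinearMap.id_apply]; abel
    rw [this]
    refine Submodule.le_orthogonal_orthogonal _ (Submodule.add_mem_sup (tangentProj_mem X y e) ?_)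
    cases Q with
    | euclidean => simp [SpaceForm.conormalProj]
    | unitSphere =>
      exact Submodule.smul_mem _ _ (Submodule.mem_span_singleton_self _)

theorem contDiffAt_normalProj (h : IsRegularAt Q X y) : ContDiffAt ℝ 2 (normalProj Q X) y := by
  have h1 : normalProj Q X =ᶠ[𝓝 y]
      fun z => ContinuousLinearMap.id ℝ E - tangentProj X z - Q.conormalProj (X z) := by
    filter_upwards [h.eventually] with z hz using normalProj_eq hz
  refine ContDiffAt.congr_of_eventuallyEq ?_ h1
  refine (contDiffAt_const.sub (contDiffAt_tangentProj h)).sub ?_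
  cases Q with
  | euclidean => exact contDiffAt_const
  | unitSphere =>
    have hX : ContDiffAt ℝ 2 X y := h.contDiffAt.of_le (by norm_num)
    exact ((innerSL ℝ (E := E)).contDiff.contDiffAt.comp y hX).smulRight hX

omit [FiniteDimensional ℝ V] in
theorem normalProj_fderiv (Q : SpaceForm) (X : V → E) (y v : V) :
    normalProj Q X y (fderiv ℝ X y v) = 0 := by
  rw [normalProj, Submodule.starProjection_apply_eq_zero_iff]
  exact Submodule.le_orthogonal_orthogonal _
    (Submodule.mem_sup_left (LinearMap.mem_range_self _ v))

omit [FiniteDimensional ℝ V] in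
theorem normalProj_conormal (Q : SpaceForm) (X : V → E) (y : V) {c : E}
    (hc : c ∈ Q.conormal (X y)) : normalProj Q X y c = 0 := by
  rw [normalProj, Submodule.starProjection_apply_eq_zero_iff]
  exact Submodule.le_orthogonal_orthogonal _ (Submodule.mem_sup_right hc)

omit [FiniteDimensional ℝ V] in
theorem normalProj_idem (Q : SpaceForm) (X : V → E) (y : V) (e : E) :
    normalProj Q X y (normalProj Q X y e) = normalProj Q X y e :=
  Submodule.starProjection_eq_self_iff.2 (Submodule.starProjection_apply_mem _ _)

omit [FiniteDimensional ℝ V] in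
theorem inner_normalProj (Q : SpaceForm) (X : V → E) (y : V) (e e' : E) :
    ⟪normalProj Q X y e, e'⟫_ℝ = ⟪e, normalProj Q X y e'⟫_ℝ :=
  Submodule.inner_starProjection_left_eq_right _ _ _

end Local

section Local

open Filter Topology

variable {V : Type*} [NormedAddCommGroup V] [NormedSpace ℝ V] [FiniteDimensional ℝ V]
variable {E : Type*} [NormedAddCommGroup E] [InnerProductSpace ℝ E] [FiniteDimensional ℝ E]
variable {Q : SpaceForm} {X : V → E} {y : V}

/-! ### The Gauss equation -/

omit [FiniteDimensional ℝ V] in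
theorem secondFundamentalForm_eq (h : IsRegularAt Q X y) (v w : V) :
    secondFundamentalForm Q X y v w = normalProj Q X y (fderiv ℝ (fderiv ℝ X) y v w) := by
  rw [secondFundamentalForm, h.fderiv_apply_const]

omit [FiniteDimensional ℝ V] in
theorem secondFundamentalForm_symm (h : IsRegularAt Q X y) (v w : V) :
    secondFundamentalForm Q X y v w = secondFundamentalForm Q X y w v := by
  rw [secondFundamentalForm_eq h, secondFundamentalForm_eq h, h.snd_symm]

omit [FiniteDimensional ℝ V] in
theorem inner_secondFundamentalForm_fderiv (Q : SpaceForm) (X : V → E) (y v w z : V) :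
    ⟪secondFundamentalForm Q X y v w, fderiv ℝ X y z⟫_ℝ = 0 := by
  rw [secondFundamentalForm, inner_normalProj, normalProj_fderiv, inner_zero_right]

omit [FiniteDimensional ℝ V] [FiniteDimensional ℝ E] in
theorem fderiv_inducedMetric (h : IsRegularAt Q X y) (v w z : V) :
    fderiv ℝ (inducedMetric X) y v w z
      = ⟪fderiv ℝ X y w, fderiv ℝ (fderiv ℝ X) y v z⟫_ℝ
        + ⟪fderiv ℝ (fderiv ℝ X) y v w, fderiv ℝ X y z⟫_ℝ := by
  have hg : DifferentiableAt ℝ (inducedMetric X) y :=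
    (contDiffAt_inducedMetric h).differentiableAt (by norm_num)
  have h1 := fderiv_inner_apply ℝ
    (h.differentiableAt_fderiv.clm_apply (differentiableAt_const w))
    (h.differentiableAt_fderiv.clm_apply (differentiableAt_const z)) v
  rw [h.fderiv_apply_const, h.fderiv_apply_const] at h1
  rw [← h1]
  change _ = fderiv ℝ (fun y' => inducedMetric X y' w z) y v
  rw [fderiv_clm_apply (hg.clm_apply (differentiableAt_const w)) (differentiableAt_const z),
    fderiv_clm_apply hg (differentiableAt_const w)]
  simp

omit [FiniteDimensional ℝ V] [FiniteDimensional ℝ E] in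
theorem christoffelLower_eq (h : IsRegularAt Q X y) (v w : V) :
    christoffelLower (inducedMetric X) y v w
      = tangentCoord X y (fderiv ℝ (fderiv ℝ X) y v w) := by
  ext z
  simp only [christoffelLower, smul_apply, sub_apply, add_apply,
    ContinuousLinearMap.flip_apply, fderiv_inducedMetric h, tangentCoord_apply, smul_eq_mul]
  rw [h.snd_symm w v, h.snd_symm z v, h.snd_symm z w,
    real_inner_comm (fderiv ℝ X y w) (fderiv ℝ (fderiv ℝ X) y v z)]
  ring

omit [FiniteDimensional ℝ V] [FiniteDimensional ℝ E] in
theorem christoffel_eq (h : IsRegularAt Q X y) (v w : V) :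
    christoffel (inducedMetric X) y v w
      = (inducedMetric X y).inverse (tangentCoord X y (fderiv ℝ (fderiv ℝ X) y v w)) := by
  rw [christoffel, christoffelLower_eq h]

omit [FiniteDimensional ℝ E] in
theorem inducedMetric_christoffel (h : IsRegularAt Q X y) (v w z : V) :
    inducedMetric X y (christoffel (inducedMetric X) y v w) z
      = ⟪fderiv ℝ (fderiv ℝ X) y v w, fderiv ℝ X y z⟫_ℝ := by
  rw [christoffel_eq h, (isInvertible_inducedMetric h.injective).self_apply_inverse]
  rfl

/-- The Gauss formula: the tangential part of `∂_v ∂_w X` is the Levi-Civita derivative. -/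
theorem fderiv_christoffel (h : IsRegularAt Q X y) (v w : V) :
    fderiv ℝ X y (christoffel (inducedMetric X) y v w)
      = fderiv ℝ (fderiv ℝ X) y v w - secondFundamentalForm .euclidean X y v w := by
  rw [secondFundamentalForm_eq h.euclidean, normalProj_eq h.euclidean, christoffel_eq h]
  simp only [SpaceForm.conormalProj, sub_zero, sub_apply, ContinuousLinearMap.id_apply,
    sub_sub_cancel]
  rfl

omit [FiniteDimensional ℝ E] in
theorem differentiableAt_christoffel (h : IsRegularAt Q X y) (v w : V) :
    DifferentiableAt ℝ (fun y' => christoffel (inducedMetric X) y' v w) y := by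
  have h1 : (fun y' => christoffel (inducedMetric X) y' v w) =ᶠ[𝓝 y] fun y' =>
      (inducedMetric X y').inverse (tangentCoord X y' (fderiv ℝ (fderiv ℝ X) y' v w)) := by
    filter_upwards [h.eventually] with z hz using christoffel_eq hz v w
  refine DifferentiableAt.congr_of_eventuallyEq ?_ h1
  refine ((contDiffAt_inverse_inducedMetric h).differentiableAt (by norm_num)).clm_apply
    (((contDiffAt_tangentCoord h).differentiableAt (by norm_num)).clm_apply ?_)
  exact (h.differentiableAt_fderiv_fderiv.clm_apply (differentiableAt_const v)).clm_apply
    (differentiableAt_const w)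

/-- The Gauss formula differentiated once more, paired with a tangent vector. -/
theorem inducedMetric_fderiv_christoffel (h : IsRegularAt Q X y) (v w z s : V) :
    inducedMetric X y (fderiv ℝ (fun y' => christoffel (inducedMetric X) y' w z) y v
        + christoffel (inducedMetric X) y v (christoffel (inducedMetric X) y w z)) s
      = ⟪fderiv ℝ (fderiv ℝ (fderiv ℝ X)) y v w z, fderiv ℝ X y s⟫_ℝ
        + ⟪secondFundamentalForm .euclidean X y w z,
            secondFundamentalForm .euclidean X y v s⟫_ℝ := by
  set Γ : V → V := fun y' => christoffel (inducedMetric X) y' w z with hΓ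
  -- `S = ∂_w ∂_z X - dX (Γ)` is normal, so `⟪∂_v S, ∂_s X⟫ = -⟪S, ∂_v ∂_s X⟫`.
  set S : V → E := fun y' => secondFundamentalForm .euclidean X y' w z with hS
  have hΓd : DifferentiableAt ℝ Γ y := differentiableAt_christoffel h w z
  have hHd : DifferentiableAt ℝ (fun y' => fderiv ℝ (fderiv ℝ X) y' w z) y :=
    (h.differentiableAt_fderiv_fderiv.clm_apply (differentiableAt_const w)).clm_apply
      (differentiableAt_const z)
  have hDΓ : DifferentiableAt ℝ (fun y' => fderiv ℝ X y' (Γ y')) y :=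
    h.differentiableAt_fderiv.clm_apply hΓd
  have hSeq : S =ᶠ[𝓝 y] fun y' => fderiv ℝ (fderiv ℝ X) y' w z - fderiv ℝ X y' (Γ y') := by
    filter_upwards [h.eventually] with a ha
    simp only [hΓ, hS, fderiv_christoffel ha, sub_sub_cancel]
  have hSd : DifferentiableAt ℝ S y :=
    DifferentiableAt.congr_of_eventuallyEq (hHd.sub hDΓ) hSeq
  have e1 : fderiv ℝ S y v = fderiv ℝ (fderiv ℝ (fderiv ℝ X)) y v w z
      - (fderiv ℝ X y (fderiv ℝ Γ y v) + fderiv ℝ (fderiv ℝ X) y v (Γ y)) := by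
    rw [hSeq.fderiv_eq, fderiv_fun_sub hHd hDΓ, fderiv_clm_apply h.differentiableAt_fderiv hΓd,
      fderiv_clm_apply (h.differentiableAt_fderiv_fderiv.clm_apply (differentiableAt_const w))
        (differentiableAt_const z),
      fderiv_clm_apply h.differentiableAt_fderiv_fderiv (differentiableAt_const w)]
    simp
  have e2 : ⟪fderiv ℝ S y v, fderiv ℝ X y s⟫_ℝ
      = - ⟪S y, secondFundamentalForm .euclidean X y v s⟫_ℝ := by
    have h0 : (fun y' => ⟪S y', fderiv ℝ X y' s⟫_ℝ) = fun _ => 0 := by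
      ext y'; exact inner_secondFundamentalForm_fderiv _ _ _ _ _ _
    have h2 := fderiv_inner_apply ℝ hSd
      (h.differentiableAt_fderiv.clm_apply (differentiableAt_const s)) v
    rw [h0, fderiv_fun_const, h.fderiv_apply_const] at h2
    simp only [Pi.zero_apply, zero_apply] at h2
    have h3 : ⟪S y, secondFundamentalForm .euclidean X y v s⟫_ℝ
        = ⟪S y, fderiv ℝ (fderiv ℝ X) y v s⟫_ℝ := by
      rw [secondFundamentalForm_eq h.euclidean v s, ← inner_normalProj]
      simp only [hS, secondFundamentalForm, normalProj_idem]
    rw [h3]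
    linarith
  rw [e1, inner_sub_left, inner_add_left] at e2
  rw [map_add, add_apply, inducedMetric_christoffel h, inducedMetric_apply]
  change _ + ⟪fderiv ℝ (fderiv ℝ X) y v (Γ y), _⟫_ℝ = _ + ⟪S y, _⟫_ℝ
  linarith

omit [FiniteDimensional ℝ V] [FiniteDimensional ℝ E] in
theorem fderiv_snd_symm (h : IsRegularAt Q X y) (v w z : V) :
    fderiv ℝ (fderiv ℝ (fderiv ℝ X)) y v w z = fderiv ℝ (fderiv ℝ (fderiv ℝ X)) y w v z := by
  rw [h.contDiffAt_fderiv.isSymmSndFDerivAt (by simp) v w]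

/-- The Gauss equation in Euclidean space. -/
theorem gauss_equation (h : IsRegularAt Q X y) (v w z s : V) :
    inducedMetric X y (riemannCurvature (inducedMetric X) y v w z) s
      = ⟪secondFundamentalForm .euclidean X y w z, secondFundamentalForm .euclidean X y v s⟫_ℝ
        - ⟪secondFundamentalForm .euclidean X y v z,
            secondFundamentalForm .euclidean X y w s⟫_ℝ := by
  rw [riemannCurvature, map_sub, sub_apply, inducedMetric_fderiv_christoffel h,
    inducedMetric_fderiv_christoffel h, fderiv_snd_symm h]
  ring

/-- The unit sphere is totally umbilical in Euclidean space. -/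
theorem secondFundamentalForm_euclidean_eq (h : IsRegularAt .unitSphere X y) (v w : V) :
    secondFundamentalForm .euclidean X y v w
      = secondFundamentalForm .unitSphere X y v w - inducedMetric X y v w • X y := by
  rw [secondFundamentalForm_eq h.euclidean, secondFundamentalForm_eq h, normalProj_eq h,
    normalProj_eq h.euclidean]
  simp only [SpaceForm.conormalProj, sub_apply, ContinuousLinearMap.id_apply, zero_apply,
    ContinuousLinearMap.smulRight_apply, innerSL_apply_apply, h.inner_self_snd,
    inducedMetric_apply]
  module

theorem inner_secondFundamentalForm_euclidean (h : IsRegularAt Q X y) (v w z s : V) :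
    ⟪secondFundamentalForm .euclidean X y v w, secondFundamentalForm .euclidean X y z s⟫_ℝ
      = ⟪secondFundamentalForm Q X y v w, secondFundamentalForm Q X y z s⟫_ℝ
        + Q.curvature * (inducedMetric X y v w * inducedMetric X y z s) := by
  cases Q with
  | euclidean => simp [SpaceForm.curvature]
  | unitSphere =>
    have hX : ⟪X y, X y⟫_ℝ = 1 := by
      rw [real_inner_self_eq_norm_sq, show ‖X y‖ = 1 from h.mem_self, one_pow]
    have h0 : ∀ v w, ⟪secondFundamentalForm .unitSphere X y v w, X y⟫_ℝ = 0 := fun v w => by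
      rw [secondFundamentalForm, inner_normalProj,
        normalProj_conormal _ _ _ (Submodule.mem_span_singleton_self _), inner_zero_right]
    rw [secondFundamentalForm_euclidean_eq h, secondFundamentalForm_euclidean_eq h]
    simp only [inner_sub_left, inner_sub_right, inner_smul_left, inner_smul_right, h0, hX,
      real_inner_comm _ (X y), SpaceForm.curvature]
    simp [mul_comm]

/-! ### The Ricci equation -/

theorem differentiableAt_normalProj (h : IsRegularAt Q X y) :
    DifferentiableAt ℝ (normalProj Q X) y :=
  (contDiffAt_normalProj h).differentiableAt (by norm_num)

/-- The curvature of the normal connection in terms of the derivative of the projection. -/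
theorem normalCurvature_eq (h : IsRegularAt Q X y) (v w : V) (ξ : E) :
    normalCurvature Q X y v w ξ = normalProj Q X y
      (fderiv ℝ (normalProj Q X) y v (fderiv ℝ (normalProj Q X) y w ξ)
        - fderiv ℝ (normalProj Q X) y w (fderiv ℝ (normalProj Q X) y v ξ)) := by
  set P := normalProj Q X with hP
  have hPd := differentiableAt_normalProj h
  have hP2 : ContDiffAt ℝ 2 P y := contDiffAt_normalProj h
  have hP2d : DifferentiableAt ℝ (fderiv ℝ P) y :=
    (hP2.fderiv_right (m := 1) (by norm_num)).differentiableAt (by norm_num)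
  have key : ∀ v w, normalDeriv Q X (normalDeriv Q X (fun y' => P y' ξ) w) v y
      = P y (P y (fderiv ℝ (fderiv ℝ P) y v w ξ) + fderiv ℝ P y v (fderiv ℝ P y w ξ)) := by
    intro v w
    have e : (normalDeriv Q X (fun y' => P y' ξ) w) =ᶠ[𝓝 y]
        fun y' => P y' (fderiv ℝ P y' w ξ) := by
      filter_upwards [h.eventually] with z hz
      rw [normalDeriv, fderiv_clm_apply (differentiableAt_normalProj hz) (differentiableAt_const ξ)]
      simp [hP]
    rw [normalDeriv, e.fderiv_eq, fderiv_clm_apply hPd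
      ((hP2d.clm_apply (differentiableAt_const w)).clm_apply (differentiableAt_const ξ)),
      fderiv_clm_apply (hP2d.clm_apply (differentiableAt_const w)) (differentiableAt_const ξ),
      fderiv_clm_apply hP2d (differentiableAt_const w)]
    simp [hP]
  rw [normalCurvature, key, key, hP2.isSymmSndFDerivAt (by simp) w v]
  simp only [map_add, map_sub]
  abel

theorem inner_fderiv_normalProj (h : IsRegularAt Q X y) (v : V) (a b : E) :
    ⟪fderiv ℝ (normalProj Q X) y v a, b⟫_ℝ = ⟪a, fderiv ℝ (normalProj Q X) y v b⟫_ℝ := by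
  have hPd := differentiableAt_normalProj h
  have h1 := fderiv_inner_apply ℝ (hPd.clm_apply (differentiableAt_const a))
    (differentiableAt_const b) v
  have h2 := fderiv_inner_apply ℝ (differentiableAt_const a)
    (hPd.clm_apply (differentiableAt_const b)) v
  have e : (fun y' => ⟪normalProj Q X y' a, b⟫_ℝ) = fun y' => ⟪a, normalProj Q X y' b⟫_ℝ := by
    ext; exact inner_normalProj _ _ _ _ _
  rw [e, h2, fderiv_clm_apply hPd (differentiableAt_const _),
    fderiv_clm_apply hPd (differentiableAt_const _)] at h1
  simpa using h1.symm

/-- Differentiating `P² = P`. -/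
theorem normalProj_fderiv_normalProj (h : IsRegularAt Q X y) (v : V) {ξ : E}
    (hξ : normalProj Q X y ξ = ξ) :
    normalProj Q X y (fderiv ℝ (normalProj Q X) y v ξ) = 0 := by
  have hPd := differentiableAt_normalProj h
  have hPξ := hPd.clm_apply (differentiableAt_const ξ)
  have e : (fun y' => normalProj Q X y' (normalProj Q X y' ξ)) = fun y' => normalProj Q X y' ξ := by
    ext1; exact normalProj_idem _ _ _ _
  have h1 := congrArg (fun L => L v) (congrArg (fun f => fderiv ℝ f y) e)
  rw [fderiv_clm_apply hPd hPξ, fderiv_clm_apply hPd (differentiableAt_const _)] at h1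
  simpa [hξ] using h1

/-- The Weingarten formula. -/
theorem inner_fderiv_normalProj_fderiv (h : IsRegularAt Q X y) (v z : V) (ξ : E) :
    ⟪fderiv ℝ (normalProj Q X) y v ξ, fderiv ℝ X y z⟫_ℝ
      = - ⟪secondFundamentalForm Q X y v z, ξ⟫_ℝ := by
  have hPd := differentiableAt_normalProj h
  have e : (fun y' => normalProj Q X y' (fderiv ℝ X y' z)) = fun _ => 0 := by
    ext1; exact normalProj_fderiv _ _ _ _
  have h1 := congrArg (fun L => L v) (congrArg (fun f => fderiv ℝ f y) e)
  rw [fderiv_clm_apply hPd (h.differentiableAt_fderiv.clm_apply (differentiableAt_const z)),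
    fderiv_clm_apply h.differentiableAt_fderiv (differentiableAt_const z)] at h1
  simp only [fderiv_fun_const, Pi.zero_apply, ContinuousLinearMap.comp_zero, zero_add,
    add_apply, ContinuousLinearMap.comp_apply, ContinuousLinearMap.flip_apply, zero_apply] at h1
  rw [inner_fderiv_normalProj h, secondFundamentalForm_eq h, eq_neg_of_add_eq_zero_right h1,
    inner_neg_right, real_inner_comm]

/-- In the unit sphere, differentiating `P X = 0` shows that the derivative of the normal projection
`P` has no component along the position vector. -/
theorem fderiv_normalProj_conormal (h : IsRegularAt Q X y) (v : V) (ξ : E) :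
    Q.conormalProj (X y) (fderiv ℝ (normalProj Q X) y v ξ) = 0 := by
  cases Q with
  | euclidean => rfl
  | unitSphere =>
    have hPd := differentiableAt_normalProj h
    have e : (fun y' => normalProj .unitSphere X y' (X y')) = fun _ => 0 := by
      ext1; exact normalProj_conormal _ _ _ (Submodule.mem_span_singleton_self _)
    have h1 := congrArg (fun L => L v) (congrArg (fun f => fderiv ℝ f y) e)
    rw [fderiv_clm_apply hPd h.differentiableAt] at h1
    simp only [fderiv_fun_const, Pi.zero_apply, add_apply, ContinuousLinearMap.comp_apply,
      ContinuousLinearMap.flip_apply, zero_apply, normalProj_fderiv, zero_add] at h1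
    have h2 : ⟪X y, fderiv ℝ (normalProj .unitSphere X) y v ξ⟫_ℝ = 0 := by
      rw [← inner_fderiv_normalProj h, h1, inner_zero_left]
    simp [SpaceForm.conormalProj, h2]

/-- The derivative of the normal projection maps normal vectors to tangent vectors. -/
theorem fderiv_normalProj_mem (h : IsRegularAt Q X y) (v : V) (ξ : E)
    (hξ : normalProj Q X y ξ = ξ) : fderiv ℝ (normalProj Q X) y v ξ ∈ tangentSpace X y := by
  have h1 := normalProj_fderiv_normalProj h v hξ
  have h2 := fderiv_normalProj_conormal h v ξ
  set ζ := fderiv ℝ (normalProj Q X) y v ξ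
  rw [normalProj_eq h, sub_apply, sub_apply, h2, sub_zero, ContinuousLinearMap.id_apply,
    sub_eq_zero] at h1
  rw [h1]
  exact tangentProj_mem _ _ _

omit [FiniteDimensional ℝ V] in
theorem inner_eq_sum_tangentFrame (X : V → E) (y : V) {a b : E} (ha : a ∈ tangentSpace X y)
    (hb : b ∈ tangentSpace X y) :
    ⟪a, b⟫_ℝ = ∑ k, ⟪a, fderiv ℝ X y (tangentFrame X y k)⟫_ℝ
      * ⟪b, fderiv ℝ X y (tangentFrame X y k)⟫_ℝ := by
  have := (stdOrthonormalBasis ℝ (tangentSpace X y)).sum_inner_mul_inner ⟨a, ha⟩ ⟨b, hb⟩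
  simp only [Submodule.coe_inner] at this
  rw [← this]
  refine Finset.sum_congr rfl fun k _ => ?_
  rw [fderiv_tangentFrame, real_inner_comm _ b]

/-- The Ricci equation. -/
theorem ricci_equation (h : IsRegularAt Q X y) (v w : V) {ξ η : E}
    (hξ : normalProj Q X y ξ = ξ) (hη : normalProj Q X y η = η) :
    ⟪normalCurvature Q X y v w ξ, η⟫_ℝ
      = ∑ k, (⟪secondFundamentalForm Q X y w (tangentFrame X y k), ξ⟫_ℝ
            * ⟪secondFundamentalForm Q X y v (tangentFrame X y k), η⟫_ℝ
          - ⟪secondFundamentalForm Q X y v (tangentFrame X y k), ξ⟫_ℝ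
            * ⟪secondFundamentalForm Q X y w (tangentFrame X y k), η⟫_ℝ) := by
  rw [normalCurvature_eq h, inner_normalProj, hη, inner_sub_left,
    inner_fderiv_normalProj h v _ η, inner_fderiv_normalProj h w _ η,
    inner_eq_sum_tangentFrame X y (fderiv_normalProj_mem h w ξ hξ) (fderiv_normalProj_mem h v η hη),
    inner_eq_sum_tangentFrame X y (fderiv_normalProj_mem h v ξ hξ) (fderiv_normalProj_mem h w η hη),
    ← Finset.sum_sub_distrib]
  simp only [inner_fderiv_normalProj_fderiv h,
    neg_mul_neg]

end Local

/-! ### The DDVV equation in terms of shape operators -/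

theorem sum_ite_lt_eq_half {n : ℕ} (f : Fin n → Fin n → ℝ) (hs : ∀ i j, f i j = f j i)
    (hd : ∀ i, f i i = 0) :
    ∑ i, ∑ j, (if i < j then f i j else 0) = 1 / 2 * ∑ i, ∑ j, f i j := by
  have h1 : ∀ i j, f i j = (if i < j then f i j else 0) + if j < i then f j i else 0 := by
    intro i j
    rcases lt_trichotomy i j with h | h | h
    · simp [h, h.le.not_gt]
    · subst h; simp [hd]
    · simp [h, h.le.not_gt, hs]
  have h2 : ∑ i, ∑ j, f i j = ∑ i, ∑ j, (if i < j then f i j else 0)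
      + ∑ i, ∑ j, (if j < i then f j i else 0) := by
    simp only [← Finset.sum_add_distrib]
    exact Finset.sum_congr rfl fun i _ => Finset.sum_congr rfl fun j _ => h1 i j
  rw [Finset.sum_comm (f := fun i j => if j < i then f j i else 0)] at h2
  linarith

section Local

variable {V : Type*} [NormedAddCommGroup V] [NormedSpace ℝ V]
variable {E : Type*} [NormedAddCommGroup E] [InnerProductSpace ℝ E] [FiniteDimensional ℝ E]
variable {Q : SpaceForm} {X : V → E} {y : V}

/-- The matrices of the shape operators of the chosen normal frame in the chosen tangent frame. -/
noncomputable def shapeMatrix (Q : SpaceForm) (X : V → E) (y : V)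
    (a : Fin (finrank ℝ (normalSpace Q X y))) :
    Matrix (Fin (finrank ℝ (tangentSpace X y))) (Fin (finrank ℝ (tangentSpace X y))) ℝ :=
  Matrix.of fun i j =>
    ⟪secondFundamentalForm Q X y (tangentFrame X y i) (tangentFrame X y j),
      normalFrame Q X y a⟫_ℝ

/-- The sum of the squared traces of the shape operators, that is, `‖d H‖²`. -/
noncomputable def traceSq (Q : SpaceForm) (X : V → E) (y : V) : ℝ :=
  ∑ a, (shapeMatrix Q X y a).trace ^ 2

/-- The squared norm of the second fundamental form. -/
noncomputable def shapeSq (Q : SpaceForm) (X : V → E) (y : V) : ℝ :=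
  ∑ a, frob (shapeMatrix Q X y a) (shapeMatrix Q X y a)

/-- The sum of the squared norms of all commutators of shape operators. -/
noncomputable def commSq (Q : SpaceForm) (X : V → E) (y : V) : ℝ :=
  ∑ a, ∑ b, frob ⁅shapeMatrix Q X y a, shapeMatrix Q X y b⁆
    ⁅shapeMatrix Q X y a, shapeMatrix Q X y b⁆

theorem shapeMatrix_isSymm (h : IsRegularAt Q X y) (a : Fin (finrank ℝ (normalSpace Q X y))) :
    (shapeMatrix Q X y a).IsSymm := by
  ext i j
  simp only [Matrix.transpose_apply, shapeMatrix, Matrix.of_apply]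
  rw [secondFundamentalForm_symm h]

theorem normalProj_normalFrame (a : Fin (finrank ℝ (normalSpace Q X y))) :
    normalProj Q X y (normalFrame Q X y a) = normalFrame Q X y a :=
  Submodule.starProjection_eq_self_iff.2 (stdOrthonormalBasis ℝ (normalSpace Q X y) a).2

theorem inner_eq_sum_normalFrame {ξ η : E} (hξ : ξ ∈ normalSpace Q X y)
    (hη : η ∈ normalSpace Q X y) :
    ⟪ξ, η⟫_ℝ = ∑ a, ⟪ξ, normalFrame Q X y a⟫_ℝ * ⟪η, normalFrame Q X y a⟫_ℝ := by
  have := (stdOrthonormalBasis ℝ (normalSpace Q X y)).sum_inner_mul_inner ⟨ξ, hξ⟩ ⟨η, hη⟩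
  simp only [Submodule.coe_inner] at this
  rw [← this]
  refine Finset.sum_congr rfl fun k _ => ?_
  rw [normalFrame, real_inner_comm _ η]

theorem secondFundamentalForm_mem (Q : SpaceForm) (X : V → E) (y v w : V) :
    secondFundamentalForm Q X y v w ∈ normalSpace Q X y :=
  Submodule.starProjection_apply_mem _ _

theorem inner_secondFundamentalForm_tangentFrame
    (i j k l : Fin (finrank ℝ (tangentSpace X y))) :
    ⟪secondFundamentalForm Q X y (tangentFrame X y i) (tangentFrame X y j),
      secondFundamentalForm Q X y (tangentFrame X y k) (tangentFrame X y l)⟫_ℝ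
      = ∑ a, shapeMatrix Q X y a i j * shapeMatrix Q X y a k l :=
  inner_eq_sum_normalFrame (secondFundamentalForm_mem _ _ _ _ _)
    (secondFundamentalForm_mem _ _ _ _ _)

theorem norm_sq_localMeanCurvature :
    ‖localMeanCurvature Q X y‖ ^ 2 = traceSq Q X y / (finrank ℝ V : ℝ) ^ 2 := by
  rw [localMeanCurvature, norm_smul, mul_pow,
    ← real_inner_self_eq_norm_sq (∑ j, _),
    inner_eq_sum_normalFrame (Q := Q) (X := X) (y := y)
      (Submodule.sum_mem _ fun i _ => secondFundamentalForm_mem _ _ _ _ _)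
      (Submodule.sum_mem _ fun i _ => secondFundamentalForm_mem _ _ _ _ _)]
  simp only [sum_inner]
  have hn : ‖(1 / (finrank ℝ V : ℝ))‖ ^ 2 = ((finrank ℝ V : ℝ) ^ 2)⁻¹ := by simp
  rw [hn, traceSq, ← div_eq_inv_mul]
  congr 1
  exact Finset.sum_congr rfl fun a _ => (sq _).symm

theorem localMeanCurvature_eq_zero_iff (hd : finrank ℝ V ≠ 0) :
    localMeanCurvature Q X y = 0 ↔ traceSq Q X y = 0 := by
  have hd' : ((finrank ℝ V : ℝ)) ^ 2 ≠ 0 := pow_ne_zero _ (Nat.cast_ne_zero.2 hd)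
  rw [← norm_eq_zero, ← pow_eq_zero_iff two_ne_zero, norm_sq_localMeanCurvature,
    div_eq_zero_iff, or_iff_left hd']

variable [FiniteDimensional ℝ V]

omit [FiniteDimensional ℝ E] [FiniteDimensional ℝ V] in
theorem finrank_tangentSpace (h : IsRegularAt Q X y) :
    finrank ℝ (tangentSpace X y) = finrank ℝ V :=
  LinearMap.finrank_range_of_inj h.injective

/-- The contracted Gauss equation. -/
theorem localScalarCurvature_eq (h : IsRegularAt Q X y) (hd : 2 ≤ finrank ℝ V) :
    localScalarCurvature X y = Q.curvature
      + (traceSq Q X y - shapeSq Q X y) / ((finrank ℝ V : ℝ) * ((finrank ℝ V : ℝ) - 1)) := by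
  have hterm : ∀ i j, inducedMetric X y
        (riemannCurvature (inducedMetric X) y (tangentFrame X y i) (tangentFrame X y j)
          (tangentFrame X y j)) (tangentFrame X y i)
      = ∑ a, (shapeMatrix Q X y a i i * shapeMatrix Q X y a j j
          - shapeMatrix Q X y a i j * shapeMatrix Q X y a i j)
        + Q.curvature * (1 - if i = j then 1 else 0) := fun i j => by
    rw [gauss_equation h, inner_secondFundamentalForm_euclidean h,
      inner_secondFundamentalForm_euclidean h, inner_secondFundamentalForm_tangentFrame,
      inner_secondFundamentalForm_tangentFrame]
    simp only [inducedMetric_tangentFrame, Finset.sum_sub_distrib, if_true]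
    have h1 : ∀ a, shapeMatrix Q X y a j i = shapeMatrix Q X y a i j := fun a =>
      (shapeMatrix_isSymm h a).apply i j
    have h2 : ∀ a, shapeMatrix Q X y a j j * shapeMatrix Q X y a i i
        = shapeMatrix Q X y a i i * shapeMatrix Q X y a j j := fun a => mul_comm _ _
    simp only [h1, h2]
    by_cases hij : i = j
    · subst hij; simp
    · simp only [hij, Ne.symm hij, if_false]; ring
  have hfr : (finrank ℝ (tangentSpace X y) : ℝ) = finrank ℝ V := by
    rw [finrank_tangentSpace h]
  have hsum : ∑ i, ∑ j, (∑ a, (shapeMatrix Q X y a i i * shapeMatrix Q X y a j j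
          - shapeMatrix Q X y a i j * shapeMatrix Q X y a i j)
        + Q.curvature * (1 - if i = j then 1 else 0))
      = traceSq Q X y - shapeSq Q X y
        + Q.curvature * ((finrank ℝ V : ℝ) * ((finrank ℝ V : ℝ) - 1)) := by
    have e1 : ∑ i, ∑ j, ∑ a, (shapeMatrix Q X y a i i * shapeMatrix Q X y a j j
          - shapeMatrix Q X y a i j * shapeMatrix Q X y a i j)
        = traceSq Q X y - shapeSq Q X y := by
      rw [traceSq, shapeSq, ← Finset.sum_sub_distrib]
      have : ∀ a, (shapeMatrix Q X y a).trace ^ 2 - frob (shapeMatrix Q X y a) (shapeMatrix Q X y a)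
          = ∑ i, ∑ j, (shapeMatrix Q X y a i i * shapeMatrix Q X y a j j
          - shapeMatrix Q X y a i j * shapeMatrix Q X y a i j) := fun a => by
        simp only [Matrix.trace, Matrix.diag, sq, Finset.sum_mul_sum, frob,
          Finset.sum_sub_distrib]
      simp only [this]
      exact Finset.sum_comm_cycle
    simp only [Finset.sum_add_distrib, e1]
    congr 1
    simp only [← Finset.mul_sum, Finset.sum_sub_distrib, Finset.sum_ite_eq, Finset.mem_univ,
      if_true, Finset.sum_const, Finset.card_univ, Fintype.card_fin, nsmul_eq_mul, hfr]
    ring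
  rw [localScalarCurvature]
  simp only [hterm]
  rw [sum_ite_lt_eq_half (fun i j => _) ?_ ?_, hsum]
  · have h2 : (2 : ℝ) ≤ finrank ℝ V := by exact_mod_cast hd
    have h3 : (finrank ℝ V : ℝ) ≠ 0 := by linarith
    have h4 : (finrank ℝ V : ℝ) - 1 ≠ 0 := by linarith
    field_simp
    ring
  · intro i j
    congr 1
    · refine Finset.sum_congr rfl fun a _ => ?_
      rw [(shapeMatrix_isSymm h a).apply i j]; ring
    · simp only [eq_comm]
  · intro i
    simp

/-- The Ricci equation, in norm. -/
theorem localNormalScalarCurvature_eq (h : IsRegularAt Q X y) :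
    localNormalScalarCurvature Q X y
      = √(commSq Q X y) / ((finrank ℝ V : ℝ) * ((finrank ℝ V : ℝ) - 1)) := by
  have hterm : ∀ i j a b, ⟪normalCurvature Q X y (tangentFrame X y i) (tangentFrame X y j)
        (normalFrame Q X y a), normalFrame Q X y b⟫_ℝ
      = ⁅shapeMatrix Q X y b, shapeMatrix Q X y a⁆ i j := fun i j a b => by
    rw [ricci_equation h _ _ (normalProj_normalFrame a) (normalProj_normalFrame b), Ring.lie_def,
      Matrix.sub_apply, Matrix.mul_apply, Matrix.mul_apply, ← Finset.sum_sub_distrib]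
    refine Finset.sum_congr rfl fun k _ => ?_
    rw [(shapeMatrix_isSymm h a).apply j k, (shapeMatrix_isSymm h b).apply j k]
    simp only [shapeMatrix, Matrix.of_apply]
    ring
  have hanti : ∀ a b i j, ⁅shapeMatrix Q X y b, shapeMatrix Q X y a⁆ i j
      = - ⁅shapeMatrix Q X y a, shapeMatrix Q X y b⁆ i j := fun a b i j => by
    simp only [Ring.lie_def, Matrix.sub_apply]; ring
  have hskew : ∀ a b i j, ⁅shapeMatrix Q X y b, shapeMatrix Q X y a⁆ j i
      = - ⁅shapeMatrix Q X y b, shapeMatrix Q X y a⁆ i j := fun a b i j => by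
    have : ⁅shapeMatrix Q X y b, shapeMatrix Q X y a⁆.transpose
        = - ⁅shapeMatrix Q X y b, shapeMatrix Q X y a⁆ := by
      rw [Ring.lie_def, Matrix.transpose_sub, Matrix.transpose_mul, Matrix.transpose_mul,
        (shapeMatrix_isSymm h a).eq, (shapeMatrix_isSymm h b).eq, neg_sub]
    exact congrFun (congrFun this i) j
  have hN : localNormalCurvatureNorm Q X y = 1 / 2 * √(commSq Q X y) := by
    rw [localNormalCurvatureNorm]
    simp only [hterm]
    rw [sum_ite_lt_eq_half (fun i j => _) ?_ ?_]
    · have : ∀ i j, ∑ a, ∑ b,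
            (if a < b then ⁅shapeMatrix Q X y b, shapeMatrix Q X y a⁆ i j ^ 2 else 0)
          = 1 / 2 * ∑ a, ∑ b, ⁅shapeMatrix Q X y b, shapeMatrix Q X y a⁆ i j ^ 2 := fun i j =>
        sum_ite_lt_eq_half (fun a b => ⁅shapeMatrix Q X y b, shapeMatrix Q X y a⁆ i j ^ 2)
          (fun a b => by rw [hanti, neg_sq]) (fun a => by simp [Ring.lie_def])
      simp only [this, ← Finset.mul_sum]
      rw [← mul_assoc, show (1 / 2 * (1 / 2) : ℝ) = (1 / 2) ^ 2 by norm_num,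
        Real.sqrt_mul (by positivity), Real.sqrt_sq (by norm_num)]
      congr 2
      simp only [commSq, frob, ← sq]
      rw [Finset.sum_comm_cycle]
      refine Finset.sum_congr rfl fun a _ => ?_
      rw [Finset.sum_comm_cycle]
      refine Finset.sum_congr rfl fun b _ => Finset.sum_congr rfl fun i _ =>
        Finset.sum_congr rfl fun j _ => ?_
      rw [hanti, neg_sq]
    · intro i j
      simp only [hskew _ _ i j, neg_sq]
    · intro i
      have : ∀ a b, ⁅shapeMatrix Q X y b, shapeMatrix Q X y a⁆ i i = 0 := fun a b => by
        linarith [hskew a b i i]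
      simp [this]
  rw [localNormalScalarCurvature, hN]
  ring

/-- Equality in the DDVV inequality in terms of the shape operators. -/
theorem ddvv_equality_iff (h : IsRegularAt Q X y) (hd : 2 ≤ finrank ℝ V) :
    localScalarCurvature X y
        = Q.curvature + ‖localMeanCurvature Q X y‖ ^ 2 - localNormalScalarCurvature Q X y
      ↔ shapeSq Q X y - √(commSq Q X y) = traceSq Q X y / finrank ℝ V := by
  have h2 : (2 : ℝ) ≤ finrank ℝ V := by exact_mod_cast hd
  have h3 : (finrank ℝ V : ℝ) ≠ 0 := by linarith
  have h4 : (finrank ℝ V : ℝ) - 1 ≠ 0 := by linarith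
  rw [localScalarCurvature_eq h hd, localNormalScalarCurvature_eq h, norm_sq_localMeanCurvature]
  field_simp
  constructor <;> intro h5 <;> linarith

omit [FiniteDimensional ℝ V] in
/-- The DDVV inequality. -/
theorem traceSq_div_le (h : IsRegularAt Q X y) (hd : 2 ≤ finrank ℝ V) :
    traceSq Q X y / finrank ℝ V ≤ shapeSq Q X y - √(commSq Q X y) := by
  have hfr := finrank_tangentSpace h
  have : Nonempty (Fin (finrank ℝ (tangentSpace X y))) := ⟨⟨0, by omega⟩⟩
  have := sum_trace_sq_div_le (shapeMatrix Q X y) (shapeMatrix_isSymm h)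
  rw [Fintype.card_fin] at this
  rwa [← hfr]

end Local

/-! ### The cone in coordinates -/

section ConeCoordinates

open Filter Topology

variable {V : Type*} [NormedAddCommGroup V] [NormedSpace ℝ V]
variable {K : Type*} [NormedAddCommGroup K] [InnerProductSpace ℝ K]
variable {E : Type*} [NormedAddCommGroup E] [InnerProductSpace ℝ E]

/-- The cone over a parametrised submanifold `U : V → E` of the unit sphere. -/
def coneMap (K : Type*) (U : V → E) (q : ℝ × K × V) : WithLp 2 (K × E) :=
  WithLp.toLp 2 (q.2.1, q.1 • U q.2.2)

theorem hasFDerivAt_coneMap {U : V → E} {q : ℝ × K × V} (hU : DifferentiableAt ℝ U q.2.2) :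
    HasFDerivAt (coneMap K U)
      (((WithLp.prodContinuousLinearEquiv 2 ℝ K E).symm : K × E →L[ℝ] WithLp 2 (K × E)).comp
        (((ContinuousLinearMap.fst ℝ K V).comp (ContinuousLinearMap.snd ℝ ℝ (K × V))).prod
          (q.1 • (fderiv ℝ U q.2.2).comp
              ((ContinuousLinearMap.snd ℝ K V).comp (ContinuousLinearMap.snd ℝ ℝ (K × V)))
            + (ContinuousLinearMap.fst ℝ ℝ (K × V)).smulRight (U q.2.2)))) q := by
  have h1 := ((ContinuousLinearMap.fst ℝ K V).comp
    (ContinuousLinearMap.snd ℝ ℝ (K × V))).hasFDerivAt (x := q)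
  have h2 := ((ContinuousLinearMap.snd ℝ K V).comp
    (ContinuousLinearMap.snd ℝ ℝ (K × V))).hasFDerivAt (x := q)
  exact (WithLp.prodContinuousLinearEquiv 2 ℝ K E).symm.toContinuousLinearMap.hasFDerivAt.comp q
    (h1.prodMk ((ContinuousLinearMap.fst ℝ ℝ (K × V)).hasFDerivAt.smul
      (hU.hasFDerivAt.comp q h2)))

theorem fderiv_coneMap {U : V → E} {q : ℝ × K × V} (hU : DifferentiableAt ℝ U q.2.2)
    (v : ℝ × K × V) : fderiv ℝ (coneMap K U) q v
      = WithLp.toLp 2 (v.2.1, q.1 • fderiv ℝ U q.2.2 v.2.2 + v.1 • U q.2.2) := by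
  rw [(hasFDerivAt_coneMap hU).fderiv]
  rfl

theorem inner_toLp (a b : K × E) :
    ⟪WithLp.toLp 2 a, WithLp.toLp 2 b⟫_ℝ = ⟪a.1, b.1⟫_ℝ + ⟪a.2, b.2⟫_ℝ := rfl

theorem injective_fderiv_coneMap {U : V → E} {q : ℝ × K × V}
    (hU : IsRegularAt .unitSphere U q.2.2) (hq : q.1 ≠ 0) :
    Function.Injective (fderiv ℝ (coneMap K U) q) := by
  rw [injective_iff_map_eq_zero]
  intro v hv
  rw [fderiv_coneMap hU.differentiableAt] at hv
  have h1 : v.2.1 = 0 := congrArg WithLp.fst hv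
  have h2 : q.1 • fderiv ℝ U q.2.2 v.2.2 + v.1 • U q.2.2 = 0 := congrArg WithLp.snd hv
  have h3 : v.1 = 0 := by
    have := congrArg (fun e => ⟪U q.2.2, e⟫_ℝ) h2
    simpa [inner_add_right, inner_smul_right, hU.inner_self_fderiv,
      show ‖U q.2.2‖ = 1 from hU.mem_self] using this
  have h4 : v.2.2 = 0 := by
    rw [h3, zero_smul, add_zero, smul_eq_zero_iff_right hq] at h2
    exact (injective_iff_map_eq_zero _).1 hU.injective _ h2
  exact Prod.ext h3 (Prod.ext h1 h4)

theorem isRegularAt_coneMap {U : V → E} {q : ℝ × K × V}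
    (hU : IsRegularAt .unitSphere U q.2.2) (hq : q.1 ≠ 0) :
    IsRegularAt .euclidean (coneMap K U) q := by
  refine ⟨?_, injective_fderiv_coneMap hU hq, Eventually.of_forall fun _ => trivial⟩
  have h1 : ContDiffAt ℝ 3 (fun q : ℝ × K × V => (q.2.1, q.1 • U q.2.2)) q :=
    (contDiffAt_snd.fst).prodMk
      (contDiffAt_fst.smul (hU.contDiffAt.comp q contDiffAt_snd.snd))
  exact ((WithLp.prodContinuousLinearEquiv 2 ℝ K E).symm.contDiff.contDiffAt).comp q h1

theorem snd_fderiv_coneMap [FiniteDimensional ℝ V] {U : V → E} {q : ℝ × K × V}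
    (hU : IsRegularAt .unitSphere U q.2.2) (v w : ℝ × K × V) :
    fderiv ℝ (fun q' => fderiv ℝ (coneMap K U) q' w) q v
      = WithLp.toLp 2 (0, q.1 • fderiv ℝ (fderiv ℝ U) q.2.2 v.2.2 w.2.2
          + v.1 • fderiv ℝ U q.2.2 w.2.2 + w.1 • fderiv ℝ U q.2.2 v.2.2) := by
  have hc : Tendsto (fun q' : ℝ × K × V => q'.2.2) (𝓝 q) (𝓝 q.2.2) :=
    (continuous_snd.comp continuous_snd).continuousAt
  have h1 : (fun q' => fderiv ℝ (coneMap K U) q' w) =ᶠ[𝓝 q] fun q' =>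
      (WithLp.prodContinuousLinearEquiv 2 ℝ K E).symm
        (w.2.1, q'.1 • fderiv ℝ U q'.2.2 w.2.2 + w.1 • U q'.2.2) := by
    filter_upwards [hc.eventually hU.eventually] with q' hq'
    exact fderiv_coneMap hq'.differentiableAt w
  have hp : HasFDerivAt (fun q' : ℝ × K × V => q'.2.2)
      ((ContinuousLinearMap.snd ℝ K V).comp (ContinuousLinearMap.snd ℝ ℝ (K × V))) q :=
    ((ContinuousLinearMap.snd ℝ K V).comp (ContinuousLinearMap.snd ℝ ℝ (K × V))).hasFDerivAt
  have hD : HasFDerivAt (fun q' : ℝ × K × V => fderiv ℝ U q'.2.2 w.2.2)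
      (((fderiv ℝ (fderiv ℝ U) q.2.2).flip w.2.2).comp
        ((ContinuousLinearMap.snd ℝ K V).comp (ContinuousLinearMap.snd ℝ ℝ (K × V)))) q := by
    have h2 : HasFDerivAt (fun z => fderiv ℝ U z w.2.2) ((fderiv ℝ (fderiv ℝ U) q.2.2).flip w.2.2)
        q.2.2 := by
      have := hU.differentiableAt_fderiv.hasFDerivAt.clm_apply (hasFDerivAt_const w.2.2 q.2.2)
      simpa using this
    exact h2.comp q hp
  have h3 :=
    (WithLp.prodContinuousLinearEquiv 2 ℝ K E).symm.toContinuousLinearMap.hasFDerivAt.comp q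
    (HasFDerivAt.prodMk (hasFDerivAt_const w.2.1 q)
      (((ContinuousLinearMap.fst ℝ ℝ (K × V)).hasFDerivAt.smul hD).add
        ((hU.differentiableAt.hasFDerivAt.comp q hp).const_smul w.1)))
  rw [h1.fderiv_eq]
  refine (congrArg (fun L => L v) h3.fderiv).trans ?_
  rfl

variable [FiniteDimensional ℝ K] [FiniteDimensional ℝ E]

omit [FiniteDimensional ℝ E] in
theorem mem_normalSpace_iff {Q : SpaceForm} {X : V → E} {y : V} {ξ : E} :
    ξ ∈ normalSpace Q X y ↔ (∀ v, ⟪fderiv ℝ X y v, ξ⟫_ℝ = 0) ∧ ξ ∈ (Q.conormal (X y))ᗮ := by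
  rw [normalSpace, ← Submodule.inf_orthogonal, Submodule.mem_inf]
  refine and_congr_left fun _ => ?_
  rw [Submodule.mem_orthogonal]
  constructor
  · exact fun h v => h _ (LinearMap.mem_range_self _ v)
  · rintro h _ ⟨v, rfl⟩
    exact h v

omit [FiniteDimensional ℝ E] in
theorem mem_normalSpace_unitSphere_iff {X : V → E} {y : V} {ξ : E} :
    ξ ∈ normalSpace .unitSphere X y ↔ (∀ v, ⟪fderiv ℝ X y v, ξ⟫_ℝ = 0) ∧ ⟪X y, ξ⟫_ℝ = 0 := by
  rw [mem_normalSpace_iff, SpaceForm.conormal, Submodule.mem_orthogonal_singleton_iff_inner_right]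

/-! The charts of the manifold carrying the cone cover only a part of the coordinate space, so the
remaining facts are stated for a map `C` that agrees with the cone near the point considered. -/

section Germ

variable {U : V → E} {q : ℝ × K × V} {C : ℝ × K × V → WithLp 2 (K × E)}

omit [FiniteDimensional ℝ K] [FiniteDimensional ℝ E] in
theorem fderiv_eventuallyEq_coneMap (hC : C =ᶠ[𝓝 q] coneMap K U)
    (hU : DifferentiableAt ℝ U q.2.2) (v : ℝ × K × V) : fderiv ℝ C q v
      = WithLp.toLp 2 (v.2.1, q.1 • fderiv ℝ U q.2.2 v.2.2 + v.1 • U q.2.2) := by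
  rw [hC.fderiv_eq, fderiv_coneMap hU]

omit [FiniteDimensional ℝ K] [FiniteDimensional ℝ E] in
theorem isRegularAt_of_eventuallyEq_coneMap (hC : C =ᶠ[𝓝 q] coneMap K U)
    (hU : IsRegularAt .unitSphere U q.2.2) (hq : q.1 ≠ 0) : IsRegularAt .euclidean C q := by
  have h := isRegularAt_coneMap hU hq
  exact ⟨h.contDiffAt.congr_of_eventuallyEq hC, by rw [hC.fderiv_eq]; exact h.injective,
    Eventually.of_forall fun _ => trivial⟩

omit [FiniteDimensional ℝ K] [FiniteDimensional ℝ E] in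
/-- The normal space of the cone is the normal space, in the sphere, of its link. -/
theorem mem_normalSpace_coneMap_iff  (hC : C =ᶠ[𝓝 q] coneMap K U)
    (hU : IsRegularAt .unitSphere U q.2.2) (hq : q.1 ≠ 0) {n : WithLp 2 (K × E)} :
    n ∈ normalSpace .euclidean C q ↔
      ∃ ξ ∈ normalSpace .unitSphere U q.2.2, n = WithLp.toLp 2 (0, ξ) := by
  rw [mem_normalSpace_iff]
  simp only [SpaceForm.conormal, Submodule.bot_orthogonal_eq_top, Submodule.mem_top, and_true,
    fderiv_eventuallyEq_coneMap hC hU.differentiableAt, mem_normalSpace_unitSphere_iff]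
  constructor
  · intro h
    have hn : n = WithLp.toLp 2 (n.fst, n.snd) := rfl
    rw [hn] at h
    simp only [inner_toLp] at h
    have h1 := h (0, n.fst, 0)
    have h2 := h (1, 0, 0)
    simp only [map_zero, smul_zero, zero_smul, add_zero, inner_zero_left, inner_self_eq_zero] at h1
    simp only [map_zero, smul_zero, one_smul, zero_add, inner_zero_left] at h2
    refine ⟨n.snd, ⟨fun v => ?_, h2⟩, by rw [← h1, ← hn]⟩
    have h3 := h (0, 0, v)
    simpa [inner_smul_left, hq] using h3
  · rintro ⟨ξ, ⟨h1, h2⟩, rfl⟩ v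
    simp [inner_add_left, inner_smul_left, h1, h2]

variable [FiniteDimensional ℝ V]

/-- The second fundamental form of the cone is that of its link, scaled by the radius. -/
theorem secondFundamentalForm_coneMap (hC : C =ᶠ[𝓝 q] coneMap K U)
    (hU : IsRegularAt .unitSphere U q.2.2) (hq : q.1 ≠ 0) (v w : ℝ × K × V) :
    secondFundamentalForm .euclidean C q v w
      = WithLp.toLp 2 (0, q.1 • secondFundamentalForm .unitSphere U q.2.2 v.2.2 w.2.2) := by
  have h0 : (fun q' => fderiv ℝ C q' w) =ᶠ[𝓝 q] fun q' => fderiv ℝ (coneMap K U) q' w := by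
    filter_upwards [hC.fderiv (𝕜 := ℝ)] with q' hq'
    rw [hq']
  rw [secondFundamentalForm, h0.fderiv_eq, snd_fderiv_coneMap hU, normalProj]
  refine Submodule.eq_starProjection_of_mem_of_inner_eq_zero ?_ ?_
  · exact (mem_normalSpace_coneMap_iff hC hU hq).2
      ⟨_, Submodule.smul_mem _ _ (secondFundamentalForm_mem _ _ _ _ _), rfl⟩
  · intro n hn
    obtain ⟨ξ, hξ, rfl⟩ := (mem_normalSpace_coneMap_iff hC hU hq).1 hn
    have h1 := (mem_normalSpace_unitSphere_iff.1 hξ).1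
    have h2 : normalProj .unitSphere U q.2.2 ξ = ξ := Submodule.starProjection_eq_self_iff.2 hξ
    rw [← WithLp.toLp_sub, inner_toLp]
    simp only [Prod.mk_sub_mk, inner_sub_left, inner_add_left, inner_smul_left, h1,
      secondFundamentalForm_eq hU, inner_normalProj, h2]
    simp

omit [FiniteDimensional ℝ V] in
theorem inner_tangentFrame_frame (U : V → E) (y : V) (i j) :
    ⟪fderiv ℝ U y (tangentFrame U y i), fderiv ℝ U y (tangentFrame U y j)⟫_ℝ
      = if i = j then 1 else 0 :=
  inducedMetric_tangentFrame U y i j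

/-- The components of the tangent frame of the cone along the tangent frame of its link. -/
noncomputable def coneTangentMatrix (C : ℝ × K × V → WithLp 2 (K × E)) (U : V → E) (q : ℝ × K × V) :
    Matrix (Fin (finrank ℝ (tangentSpace C q)))
      (Fin (finrank ℝ (tangentSpace U q.2.2))) ℝ :=
  Matrix.of fun c i => ⟪WithLp.toLp 2 (0, fderiv ℝ U q.2.2 (tangentFrame U q.2.2 i)),
    fderiv ℝ C q (tangentFrame C q c)⟫_ℝ

/-- The components of the normal frame of the cone along the normal frame of its link. -/
noncomputable def coneNormalMatrix (C : ℝ × K × V → WithLp 2 (K × E)) (U : V → E) (q : ℝ × K × V) :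
    Matrix (Fin (finrank ℝ (normalSpace .euclidean C q)))
      (Fin (finrank ℝ (normalSpace .unitSphere U q.2.2))) ℝ :=
  Matrix.of fun a b => ⟪WithLp.toLp 2 (0, normalFrame .unitSphere U q.2.2 b),
    normalFrame .euclidean C q a⟫_ℝ

omit [FiniteDimensional ℝ V] in
theorem coneTangentMatrix_orthonormal  (hC : C =ᶠ[𝓝 q] coneMap K U)
    (hU : IsRegularAt .unitSphere U q.2.2) (hq : q.1 ≠ 0) :
    (coneTangentMatrix C U q).transpose * coneTangentMatrix C U q = 1 := by
  have hmem : ∀ i, (WithLp.toLp 2 ((0 : K), fderiv ℝ U q.2.2 (tangentFrame U q.2.2 i)))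
      ∈ tangentSpace C q := fun i =>
    ⟨(0, 0, q.1⁻¹ • tangentFrame U q.2.2 i), by
      refine (fderiv_eventuallyEq_coneMap hC hU.differentiableAt _).trans ?_
      simp [smul_smul, hq]⟩
  ext i j
  have := inner_eq_sum_tangentFrame C q (hmem i) (hmem j)
  rw [Matrix.mul_apply, Matrix.one_apply, ← inner_tangentFrame_frame U q.2.2 i j]
  rw [inner_toLp, inner_zero_left, zero_add] at this
  exact this.symm

omit [FiniteDimensional ℝ V] in
theorem coneNormalMatrix_orthonormal  (hC : C =ᶠ[𝓝 q] coneMap K U)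
    (hU : IsRegularAt .unitSphere U q.2.2) (hq : q.1 ≠ 0)
    (b b' : Fin (finrank ℝ (normalSpace .unitSphere U q.2.2))) :
    ∑ a, coneNormalMatrix C U q a b * coneNormalMatrix C U q a b' = if b = b' then 1 else 0 := by
  have hmem : ∀ b, (WithLp.toLp 2 ((0 : K), normalFrame .unitSphere U q.2.2 b))
      ∈ normalSpace .euclidean C q := fun b =>
    (mem_normalSpace_coneMap_iff hC hU hq).2
      ⟨_, (stdOrthonormalBasis ℝ (normalSpace .unitSphere U q.2.2) b).2, rfl⟩
  have := inner_eq_sum_normalFrame (hmem b) (hmem b')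
  rw [inner_toLp, inner_zero_left, zero_add] at this
  refine this.symm.trans ?_
  exact orthonormal_iff_ite.mp (stdOrthonormalBasis ℝ (normalSpace .unitSphere U q.2.2)).orthonormal
    b b'

omit [FiniteDimensional ℝ V] in
theorem tangentFrame_coneMap (hC : C =ᶠ[𝓝 q] coneMap K U)
    (hU : IsRegularAt .unitSphere U q.2.2) (hq : q.1 ≠ 0) (c) :
    (tangentFrame C q c).2.2
      = q.1⁻¹ • ∑ i, coneTangentMatrix C U q c i • tangentFrame U q.2.2 i := by
  set v := tangentFrame C q c with hv
  have hO : ∀ i, coneTangentMatrix C U q c i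
      = q.1 * ⟪fderiv ℝ U q.2.2 (tangentFrame U q.2.2 i), fderiv ℝ U q.2.2 v.2.2⟫_ℝ := fun i => by
    rw [coneTangentMatrix, Matrix.of_apply, fderiv_eventuallyEq_coneMap hC hU.differentiableAt,
      inner_toLp, ← hv]
    simp only [inner_zero_left, zero_add, inner_add_right, inner_smul_right]
    rw [real_inner_comm (U q.2.2), hU.inner_self_fderiv, mul_zero, add_zero]
  apply hU.injective
  have h1 := (stdOrthonormalBasis ℝ (tangentSpace U q.2.2)).sum_repr'
    ⟨fderiv ℝ U q.2.2 v.2.2, LinearMap.mem_range_self _ _⟩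
  have h2 := congrArg Subtype.val h1
  simp only [Submodule.coe_sum, Submodule.coe_smul, Submodule.coe_inner,
    ← fderiv_tangentFrame] at h2
  rw [← h2, map_smul, map_sum, Finset.smul_sum]
  refine Finset.sum_congr rfl fun i _ => ?_
  rw [map_smul, smul_smul, hO, inv_mul_cancel_left₀ hq]

omit [FiniteDimensional ℝ V] in
theorem normalFrame_coneMap (hC : C =ᶠ[𝓝 q] coneMap K U)
    (hU : IsRegularAt .unitSphere U q.2.2) (hq : q.1 ≠ 0) (a) :
    normalFrame .euclidean C q a
      = WithLp.toLp 2 (0, ∑ b, coneNormalMatrix C U q a b • normalFrame .unitSphere U q.2.2 b) := by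
  obtain ⟨ξ, hξ, hn⟩ := (mem_normalSpace_coneMap_iff hC hU hq).1
    (stdOrthonormalBasis ℝ (normalSpace .euclidean C q) a).2
  have hn' : normalFrame .euclidean C q a = WithLp.toLp 2 (0, ξ) := hn
  have h1 := congrArg Subtype.val
    ((stdOrthonormalBasis ℝ (normalSpace .unitSphere U q.2.2)).sum_repr' ⟨ξ, hξ⟩)
  simp only [Submodule.coe_sum, Submodule.coe_smul, Submodule.coe_inner] at h1
  have hP : ∀ b, coneNormalMatrix C U q a b
      = ⟪normalFrame .unitSphere U q.2.2 b, ξ⟫_ℝ := fun b => by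
    rw [coneNormalMatrix, Matrix.of_apply, hn', inner_toLp]
    simp
  simp only [hn', hP]
  rw [← h1]
  simp only [normalFrame, h1]

/-- The shape operators of the cone are those of its link, divided by the radius and rotated. The
conjugating matrix is rectangular: it has more rows than columns, and they record that the cone is
flat in the radial and Euclidean directions. -/
theorem shapeMatrix_coneMap (hC : C =ᶠ[𝓝 q] coneMap K U)
    (hU : IsRegularAt .unitSphere U q.2.2) (hq : q.1 ≠ 0) (a) :
    shapeMatrix .euclidean C q a
      = ∑ b, coneNormalMatrix C U q a b • (q.1⁻¹ • (coneTangentMatrix C U q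
          * shapeMatrix .unitSphere U q.2.2 b * (coneTangentMatrix C U q).transpose)) := by
  ext c d
  rw [shapeMatrix, Matrix.of_apply, secondFundamentalForm_coneMap hC hU hq,
    normalFrame_coneMap hC hU hq, inner_toLp, inner_zero_left, zero_add, inner_sum,
    Matrix.sum_apply]
  refine Finset.sum_congr rfl fun b _ => ?_
  rw [inner_smul_right, Matrix.smul_apply, Matrix.smul_apply, smul_eq_mul, smul_eq_mul]
  congr 1
  rw [secondFundamentalForm_eq hU, tangentFrame_coneMap hC hU hq, tangentFrame_coneMap hC hU hq,
    Matrix.mul_assoc, Matrix.mul_apply]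
  simp only [map_smul, map_sum, smul_apply, sum_apply, sum_inner, inner_smul_left, Matrix.mul_apply,
    Matrix.transpose_apply, ← secondFundamentalForm_eq hU, shapeMatrix, Matrix.of_apply]
  simp only [conj_trivial]
  rw [mul_inv_cancel_left₀ hq]
  simp only [Finset.mul_sum]
  rw [Finset.sum_comm]
  exact Finset.sum_congr rfl fun i _ => Finset.sum_congr rfl fun j _ => by ring

theorem shapeSq_coneMap (hC : C =ᶠ[𝓝 q] coneMap K U)
    (hU : IsRegularAt .unitSphere U q.2.2) (hq : q.1 ≠ 0) :
    shapeSq .euclidean C q = (q.1⁻¹) ^ 2 * shapeSq .unitSphere U q.2.2 := by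
  have h := sum_frob_map _ _ (coneNormalMatrix C U q) (fun _ => 1) (shapeMatrix_coneMap hC hU hq)
    (coneNormalMatrix_orthonormal hC hU hq) LinearMap.id
  simp only [LinearMap.id_coe, id_eq, one_mul, frob_smul_left, frob_smul_right,
    frob_conj _ (coneTangentMatrix_orthonormal hC hU hq)] at h
  rw [shapeSq, h, shapeSq, Finset.mul_sum]
  exact Finset.sum_congr rfl fun b _ => by ring

theorem commSq_coneMap (hC : C =ᶠ[𝓝 q] coneMap K U)
    (hU : IsRegularAt .unitSphere U q.2.2) (hq : q.1 ≠ 0) :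
    commSq .euclidean C q = ((q.1⁻¹) ^ 2) ^ 2 * commSq .unitSphere U q.2.2 := by
  have h := sum_frob_lie_comb _ _ (coneNormalMatrix C U q) (fun _ => 1)
    (shapeMatrix_coneMap hC hU hq) (coneNormalMatrix_orthonormal hC hU hq)
  have hl : ∀ (c : ℝ) (A B : Matrix (Fin (finrank ℝ (tangentSpace C q)))
      (Fin (finrank ℝ (tangentSpace C q))) ℝ), ⁅c • A, c • B⁆ = c ^ 2 • ⁅A, B⁆ := by
    intro c A B
    simp only [Ring.lie_def, Matrix.smul_mul, Matrix.mul_smul, smul_smul, ← smul_sub, sq]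
  rw [commSq, h, commSq, Finset.mul_sum]
  refine Finset.sum_congr rfl fun b _ => ?_
  rw [Finset.mul_sum]
  refine Finset.sum_congr rfl fun b' _ => ?_
  rw [hl, lie_conj _ (coneTangentMatrix_orthonormal hC hU hq), frob_smul_left, frob_smul_right,
    frob_conj _ (coneTangentMatrix_orthonormal hC hU hq)]
  ring

theorem traceSq_coneMap (hC : C =ᶠ[𝓝 q] coneMap K U)
    (hU : IsRegularAt .unitSphere U q.2.2) (hq : q.1 ≠ 0) :
    traceSq .euclidean C q = (q.1⁻¹) ^ 2 * traceSq .unitSphere U q.2.2 := by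
  set x := fun b => (shapeMatrix .unitSphere U q.2.2 b).trace with hx
  have htr : ∀ a, (shapeMatrix .euclidean C q a).trace
      = q.1⁻¹ * ∑ b, coneNormalMatrix C U q a b * x b := fun a => by
    rw [shapeMatrix_coneMap hC hU hq, Matrix.trace_sum, Finset.mul_sum]
    refine Finset.sum_congr rfl fun b _ => ?_
    rw [Matrix.trace_smul, Matrix.trace_smul, trace_conj _ (coneTangentMatrix_orthonormal hC hU hq),
      smul_eq_mul, smul_eq_mul]
    ring
  have hsq : ∑ a, (∑ b, coneNormalMatrix C U q a b * x b) ^ 2 = ∑ b, x b ^ 2 := by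
    have h1 : ∀ a, (∑ b, coneNormalMatrix C U q a b * x b) ^ 2
        = ∑ b, ∑ b', x b * x b' * (coneNormalMatrix C U q a b * coneNormalMatrix C U q a b') :=
      fun a => by
        rw [sq, Finset.sum_mul_sum]
        exact Finset.sum_congr rfl fun b _ => Finset.sum_congr rfl fun b' _ => by ring
    simp only [h1]
    rw [← Finset.sum_comm_cycle, Finset.sum_congr rfl]
    intro b _
    simp only [← Finset.mul_sum, coneNormalMatrix_orthonormal hC hU hq]
    simp [sq]
  simp only [traceSq, htr, mul_pow, ← Finset.mul_sum, hsq]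
  rfl

end Germ

end ConeCoordinates

/-! ### The cone as an immersed submanifold -/

section Charts

open Filter Topology

variable {V : Type*} [NormedAddCommGroup V] [NormedSpace ℝ V] {H : Type*} [TopologicalSpace H]
variable (I : ModelWithCorners ℝ V H) [I.Boundaryless]
variable {M : Type*} [TopologicalSpace M] [ChartedSpace H M]
variable {E : Type*} [NormedAddCommGroup E] [InnerProductSpace ℝ E]

theorem contDiffAt_inChart {F : M → E} {n : WithTop ℕ∞} {x : M} (hF : ContMDiffAt I 𝓘(ℝ, E) n F x) :
    ContDiffAt ℝ n (inChart I F x) (extChartAt I x x) := by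
  have := (contMDiffAt_iff.1 hF).2
  rw [I.range_eq_univ, contDiffWithinAt_univ] at this
  exact this

theorem mfderiv_eq_fderiv_inChart {F : M → E} {x : M} (hF : MDifferentiableAt I 𝓘(ℝ, E) F x) :
    mfderiv I 𝓘(ℝ, E) F x = fderiv ℝ (inChart I F x) (extChartAt I x x) := by
  rw [hF.mfderiv, I.range_eq_univ, fderivWithin_univ]
  rfl

end Charts

section Sphere

open Filter Topology

variable {r n : ℕ} {M : Type*} [TopologicalSpace M] [ChartedSpace (EuclideanSpace ℝ (Fin r)) M]
  {u : M → Metric.sphere (0 : EuclideanSpace ℝ (Fin (n + 1))) 1}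

theorem contMDiff_subtypeVal_euclideanSphere (n : ℕ) :
    ContMDiff (𝓡 n) 𝓘(ℝ, EuclideanSpace ℝ (Fin (n + 1))) ∞
      (Subtype.val : Metric.sphere (0 : EuclideanSpace ℝ (Fin (n + 1))) 1 → _) := by
  have := Fact.mk (finrank_euclideanSpace_fin (𝕜 := ℝ) (n := n + 1))
  exact contMDiff_coe_sphere

theorem injective_mfderiv_subtypeVal_euclideanSphere (n : ℕ)
    (v : Metric.sphere (0 : EuclideanSpace ℝ (Fin (n + 1))) 1) :
    Function.Injective (mfderiv (𝓡 n) 𝓘(ℝ, EuclideanSpace ℝ (Fin (n + 1)))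
      (Subtype.val : Metric.sphere (0 : EuclideanSpace ℝ (Fin (n + 1))) 1 → _) v) := by
  have := Fact.mk (finrank_euclideanSpace_fin (𝕜 := ℝ) (n := n + 1))
  exact injective_mvfderiv_subtypeVal_sphere v

theorem contMDiff_subtypeVal_comp (hu : IsImmersedSubmanifold (𝓡 r) (𝓡 n) u) :
    ContMDiff (𝓡 r) 𝓘(ℝ, EuclideanSpace ℝ (Fin (n + 1))) ∞
      (fun x => (u x : EuclideanSpace ℝ (Fin (n + 1)))) :=
  (contMDiff_subtypeVal_euclideanSphere n).comp hu.1

/-- An immersion into the sphere, read in a chart and in the ambient Euclidean space. -/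
theorem isRegularAt_inChart (hu : IsImmersedSubmanifold (𝓡 r) (𝓡 n) u) (x : M) :
    IsRegularAt .unitSphere
      (inChart (𝓡 r) (fun x => (u x : EuclideanSpace ℝ (Fin (n + 1)))) x)
      (extChartAt (𝓡 r) x x) := by
  have hs := contMDiff_subtypeVal_comp hu
  refine ⟨(contDiffAt_inChart _ (hs x)).of_le (by norm_cast), ?_,
    Eventually.of_forall fun y => ?_⟩
  · rw [← mfderiv_eq_fderiv_inChart _ ((hs x).mdifferentiableAt (by simp))]
    have : (fun x => (u x : EuclideanSpace ℝ (Fin (n + 1)))) = Subtype.val ∘ u := rfl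
    rw [this, mfderiv_comp x
      ((contMDiff_subtypeVal_euclideanSphere n (u x)).mdifferentiableAt (by simp))
      ((hu.1 x).mdifferentiableAt (by simp))]
    exact (injective_mfderiv_subtypeVal_euclideanSphere n (u x)).comp (hu.2 x)
  · exact norm_eq_of_mem_sphere (u ((extChartAt (𝓡 r) x).symm y))

/-- The model with corners of the manifold carrying the cone. -/
noncomputable abbrev coneModel (k r : ℕ) := 𝓘(ℝ, ℝ).prod ((𝓡 k).prod (𝓡 r))

theorem extChartAt_cone_apply (k : ℕ) (q : PosReal × EuclideanSpace ℝ (Fin k) × M) :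
    extChartAt (coneModel k r) q q = ((q.1 : ℝ), q.2.1, extChartAt (𝓡 r) q.2.2 q.2.2) := by
  rw [extChartAt_prod, extChartAt_prod]
  rfl

/-- The chart of `ℝ⁺` is the inclusion into `ℝ`; its inverse has junk values off `ℝ⁺`. -/
theorem extChartAt_posReal_symm (t : PosReal) :
    ∀ᶠ s in 𝓝 (t : ℝ), (((extChartAt 𝓘(ℝ, ℝ) t).symm s : PosReal) : ℝ) = s := by
  have h1 : (extChartAt 𝓘(ℝ, ℝ) t).target ∈ 𝓝 (t : ℝ) := extChartAt_target_mem_nhds (I := 𝓘(ℝ, ℝ)) t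
  filter_upwards [h1] with s hs
  have := (extChartAt 𝓘(ℝ, ℝ) t).right_inv hs
  exact this

theorem inChart_cone_eventuallyEq (k : ℕ) (q : PosReal × EuclideanSpace ℝ (Fin k) × M) :
    inChart (coneModel k r) (cone k u) q =ᶠ[𝓝 (extChartAt (coneModel k r) q q)]
      coneMap (EuclideanSpace ℝ (Fin k))
        (inChart (𝓡 r) (fun x => (u x : EuclideanSpace ℝ (Fin (n + 1)))) q.2.2) := by
  rw [extChartAt_cone_apply]
  have hc : Tendsto (fun z : ℝ × EuclideanSpace ℝ (Fin k) × EuclideanSpace ℝ (Fin r) => z.1)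
      (𝓝 ((q.1 : ℝ), q.2.1, extChartAt (𝓡 r) q.2.2 q.2.2)) (𝓝 (q.1 : ℝ)) :=
    continuous_fst.continuousAt
  filter_upwards [hc.eventually (extChartAt_posReal_symm q.1)] with z hz
  rw [inChart, extChartAt_prod, extChartAt_prod]
  change WithLp.toLp 2 (z.2.1, (((extChartAt 𝓘(ℝ, ℝ) q.1).symm z.1 : PosReal) : ℝ) • _) = _
  rw [hz]
  rfl

theorem contMDiff_cone (k : ℕ) (hu : IsImmersedSubmanifold (𝓡 r) (𝓡 n) u) :
    ContMDiff (coneModel k r)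
      𝓘(ℝ, WithLp 2 (EuclideanSpace ℝ (Fin k) × EuclideanSpace ℝ (Fin (n + 1)))) ∞
      (cone k u) := by
  have hs := contMDiff_subtypeVal_comp hu
  have ht : ContMDiff 𝓘(ℝ, ℝ) 𝓘(ℝ, ℝ) ∞ (fun t : PosReal => (t : ℝ)) := contMDiff_subtype_val
  have h1 : ContMDiff (coneModel k r) 𝓘(ℝ, EuclideanSpace ℝ (Fin (n + 1))) ∞
      (fun z : PosReal × EuclideanSpace ℝ (Fin k) × M =>
        (z.1 : ℝ) • (u z.2.2 : EuclideanSpace ℝ (Fin (n + 1)))) :=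
    (ht.comp contMDiff_fst).smul (hs.comp (contMDiff_snd.comp contMDiff_snd))
  have h2 : ContMDiff (coneModel k r) (𝓡 k) ∞
      (fun z : PosReal × EuclideanSpace ℝ (Fin k) × M => z.2.1) :=
    contMDiff_fst.comp contMDiff_snd
  exact ((WithLp.prodContinuousLinearEquiv 2 ℝ (EuclideanSpace ℝ (Fin k))
    (EuclideanSpace ℝ (Fin (n + 1)))).symm.contDiff.contMDiff).comp (h2.prodMk_space h1)

theorem isRegularAt_inChart_cone (k : ℕ) (hu : IsImmersedSubmanifold (𝓡 r) (𝓡 n) u)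
    (q : PosReal × EuclideanSpace ℝ (Fin k) × M) :
    IsRegularAt .euclidean (inChart (coneModel k r) (cone k u) q)
      (extChartAt (coneModel k r) q q) := by
  have hC := inChart_cone_eventuallyEq (r := r) (u := u) k q
  rw [extChartAt_cone_apply] at hC ⊢
  exact isRegularAt_of_eventuallyEq_coneMap hC (isRegularAt_inChart hu q.2.2)
    (ne_of_gt q.1.2)

theorem isImmersedSubmanifold_cone (k : ℕ) (hu : IsImmersedSubmanifold (𝓡 r) (𝓡 n) u) :
    IsImmersedSubmanifold (coneModel k r)
      𝓘(ℝ, WithLp 2 (EuclideanSpace ℝ (Fin k) × EuclideanSpace ℝ (Fin (n + 1)))) (cone k u) := by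
  refine ⟨contMDiff_cone k hu, fun q => ?_⟩
  rw [mfderiv_eq_fderiv_inChart _ ((contMDiff_cone k hu q).mdifferentiableAt (by simp))]
  exact (isRegularAt_inChart_cone k hu q).injective

/-- The DDVV equation for the cone at a point, in terms of the link: the powers of the radius
cancel, and only the dimension by which the traces are weighted differs. -/
theorem ddvv_cone_iff (k : ℕ) (hr : 2 ≤ r) (hu : IsImmersedSubmanifold (𝓡 r) (𝓡 n) u)
    (q : PosReal × EuclideanSpace ℝ (Fin k) × M) :
    scalarCurvature (coneModel k r) (cone k u) q
        = SpaceForm.euclidean.curvature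
          + ‖meanCurvature (coneModel k r) .euclidean (cone k u) q‖ ^ 2
          - normalScalarCurvature (coneModel k r) .euclidean (cone k u) q
      ↔ shapeSq .unitSphere (inChart (𝓡 r) (fun x => (u x : EuclideanSpace ℝ (Fin (n + 1)))) q.2.2)
            (extChartAt (𝓡 r) q.2.2 q.2.2)
          - √(commSq .unitSphere
            (inChart (𝓡 r) (fun x => (u x : EuclideanSpace ℝ (Fin (n + 1)))) q.2.2)
            (extChartAt (𝓡 r) q.2.2 q.2.2))
        = traceSq .unitSphere
            (inChart (𝓡 r) (fun x => (u x : EuclideanSpace ℝ (Fin (n + 1)))) q.2.2)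
            (extChartAt (𝓡 r) q.2.2 q.2.2) / (1 + (k + r) : ℕ) := by
  have hC := inChart_cone_eventuallyEq (r := r) (u := u) k q
  have hreg := isRegularAt_inChart_cone k hu q
  have hU := isRegularAt_inChart hu q.2.2
  have ht : (q.1 : ℝ) ≠ 0 := ne_of_gt q.1.2
  have hd : finrank ℝ (ℝ × EuclideanSpace ℝ (Fin k) × EuclideanSpace ℝ (Fin r)) = 1 + (k + r) := by
    simp
  rw [scalarCurvature, meanCurvature, normalScalarCurvature,
    ddvv_equality_iff hreg (by rw [hd]; omega), hd]
  rw [extChartAt_cone_apply] at hC ⊢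
  rw [shapeSq_coneMap hC hU ht, commSq_coneMap hC hU ht, traceSq_coneMap hC hU ht]
  rw [Real.sqrt_mul (by positivity), Real.sqrt_sq (by positivity), ← mul_sub, mul_div_assoc]
  exact mul_right_inj' (by simpa using ht)

end Sphere

end WintgenIdeal

open WintgenIdeal in
theorem proposition3p2 (m r p : ℕ) (hr : 2 ≤ r) (hrm : r < m)
    {M : Type*} [TopologicalSpace M] [ChartedSpace (EuclideanSpace ℝ (Fin r)) M]
    [IsManifold (𝓡 r) ∞ M]
    (u : M → Metric.sphere (0 : EuclideanSpace ℝ (Fin (r + p + 1))) 1)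
    (hu : WintgenIdeal.IsImmersedSubmanifold (𝓡 r) (𝓡 (r + p)) u) :
    WintgenIdeal.IsWintgenIdealEuclidean
        (𝓘(ℝ, ℝ).prod ((𝓡 (m - r - 1)).prod (𝓡 r))) (WintgenIdeal.cone (m - r - 1) u) ↔
      (WintgenIdeal.IsMinimalSphere (𝓡 r) u ∧ WintgenIdeal.IsWintgenIdealSphere (𝓡 r) u) := by
  have hd : finrank ℝ (EuclideanSpace ℝ (Fin r)) = r := by simp
  have hd2 : 2 ≤ finrank ℝ (EuclideanSpace ℝ (Fin r)) := by rw [hd]; exact hr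
  have hm : 1 + (m - r - 1 + r) = m := by omega
  have hr0 : (0 : ℝ) < r := by exact_mod_cast (by omega : 0 < r)
  have hrm' : (r : ℝ) < m := by exact_mod_cast hrm
  have hU := isRegularAt_inChart hu
  have hcone := ddvv_cone_iff (m - r - 1) hr hu
  simp only [hm] at hcone
  constructor
  · rintro ⟨-, h⟩
    -- One point of the cone over each `x` is enough; take distance one and no Euclidean part.
    have key : ∀ x, traceSq .unitSphere
        (inChart (𝓡 r) (fun x => (u x : EuclideanSpace ℝ (Fin (r + p + 1)))) x)
        (extChartAt (𝓡 r) x x) = 0 := fun x => by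
      have h1 := (hcone (⟨1, Set.mem_Ioi.2 one_pos⟩, 0, x)).1 (h _)
      have h2 := traceSq_div_le (hU x) hd2
      rw [hd] at h2
      set T := traceSq .unitSphere
        (inChart (𝓡 r) (fun x => (u x : EuclideanSpace ℝ (Fin (r + p + 1)))) x)
        (extChartAt (𝓡 r) x x)
      have hT : 0 ≤ T := Finset.sum_nonneg fun _ _ => sq_nonneg _
      have h3 : T / r ≤ T / m := h2.trans h1.le
      rw [div_le_div_iff₀ hr0 (hr0.trans hrm')] at h3
      nlinarith
    refine ⟨⟨hu, fun x => ?_⟩, hu, fun x => ?_⟩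
    · exact (localMeanCurvature_eq_zero_iff (by omega)).2 (key x)
    · refine (ddvv_equality_iff (hU x) hd2).2 ?_
      have h1 := (hcone (⟨1, Set.mem_Ioi.2 one_pos⟩, 0, x)).1 (h _)
      rw [key x, zero_div] at h1 ⊢
      exact h1
  · rintro ⟨⟨-, hmin⟩, -, h⟩
    refine ⟨isImmersedSubmanifold_cone _ hu, fun q => (hcone q).2 ?_⟩
    have h0 := (localMeanCurvature_eq_zero_iff (by omega)).1 (hmin q.2.2)
    have h1 := (ddvv_equality_iff (hU q.2.2) hd2).1 (h q.2.2)
    rw [h0, zero_div] at h1 ⊢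
    exact h1
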